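/- Let $k$ be a field and $G$ a finite group with identity $e$. All algebras are associative unital $k$-algebras. * $\mathcal P'(G)$ is the set of nonempty subsets of $G$, on which $G$ acts by left translation $gX=\{gx : x\in X\}$. * $k_{glob}G$ is the algebra with basis $G\times\mathcal P'(G)$ and product $(g,A)(h,B)=(gh,B)$ if $A=hB$, and $0$ otherwise. * $\Gamma_{glob}(G)$ is the groupoid with set of objects $\mathcal P'(G)$ and with morphisms the pairs $(g,A)\in G\times\mathcal P'(G)$, where $(g,A)$ goes from $A$ to $gA$ and $(g,A)\circ(h,B)=(gh,B)$ when $A=hB$; $k\Gamma_{glob}(G)$ is its groupoid algebra. * $\mathcal B(G)$ is the semigroup algebra over $k$ of $\mathcal P'(G)$ with respect to union (it has a unit element), a $kG$-module algebra through left translation of subsets; equivalently $g\triangleright Q_X=Q_{gX}$ for the basis of orthogonal idempotents $Q_X=\sum_{Y\supseteq X}(-1)^{|Y|-|X|}Y$. * For a $kG$-module algebra $A$, the smash product $A\# kG$ is $A\otimes kG$ with product $(a\# g)(b\# h)=a(g\triangleright b)\# gh$ for $g,h\in G$. * $k_{par}G$ is the algebra generated by symbols $[g]$, $g\in G$, with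 relations $[e]=1$, $[g][h][h^{-1}]=[gh][h^{-1}]$ and $[g^{-1}][g][h]=[g^{-1}][gh]$. $A_{par}=A_{par}(G)$ is its subalgebra generated by the elements $\varepsilon_g=[g][g^{-1}]$, with the partial action $g\bullet a=[g]a[g^{-1}]$ of $G$, extended linearly to $kG$. * The standard dilation $\overline{A_{par}(G)}$ is the $kG$-submodule of $\operatorname{Hom}_k(kG,A_{par})$, with action $(g\rightharpoonup f)(x)=f(xg)$, generated by the maps $\varphi(a)\colon x\mapsto x\bullet a$, $a\in A_{par}$. It is a $kG$-module algebra under the convolution product, which is $(f*f')(g)=f(g)f'(g)$ for $g\in G$. * $\{A_{par},A_{par}\}$ is the space of linear maps $f\colon A_{par}\otimes kG\to A_{par}$ with $f((g\bullet a)\otimes gx)=g\bullet f(a\otimes x)$ for all $g\in G$, $a\in A_{par}$, $x\in kG$. It is a $kG$-module algebra with the action $(g\rightharpoonup f)(a\otimes x)=f(a\otimes xg)$ and the product $(\varphi\circ\chi)(a\otimes g)=\chi(\varphi(a\otimes g)\otimes g)$ for $g\in G$. * $(kG)_{glob}:=\{A_{par},A_{par}\}\# kG$. Then there are isomorphisms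 of $k$-algebras $$k_{glob}G\;\cong\; k\Gamma_{glob}(G)\;\cong\;\mathcal B(G)\# kG\;\cong\;\overline{A_{par}(G)}\# kG\;\cong\;\{A_{par},A_{par}\}\# kG\;=\;(kG)_{glob}.$$ -/

import Mathlib

open scoped TensorProduct Pointwise

noncomputable section

namespace PartialGlob

/-! ## Algebras given by a basis and structure constants -/

section StructureConstants

/-- The bilinear extension of a product of basis elements. -/
def bilinExt {k ι : Type*} [Field k] (m : ι → ι → (ι →₀ k)) :
    (ι →₀ k) →ₗ[k] (ι →₀ k) →ₗ[k] (ι →₀ k) :=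
  Finsupp.linearCombination k (fun i => Finsupp.linearCombination k (m i))

theorem bilinExt_single {k ι : Type*} [Field k] (m : ι → ι → (ι →₀ k)) (i j : ι) :
    bilinExt m (Finsupp.single i 1) (Finsupp.single j 1) = m i j := by
  simp [bilinExt]

/-- A product of basis elements that is associative on basis elements and has a two-sided unit
makes the space with that basis a ring. -/
abbrev structRing {k ι : Type*} [Field k] (m : ι → ι → (ι →₀ k)) (e : ι →₀ k)
    (hassoc : ∀ i j l, bilinExt m (m i j) (Finsupp.single l 1)
      = bilinExt m (Finsupp.single i 1) (m j l))
    (hleft : ∀ i, bilinExt m e (Finsupp.single i 1) = Finsupp.single i 1)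
    (hright : ∀ i, bilinExt m (Finsupp.single i 1) e = Finsupp.single i 1) : Ring (ι →₀ k) :=
  { (inferInstance : AddCommGroup (ι →₀ k)) with
    mul := fun x y => bilinExt m x y
    one := e
    left_distrib := fun x y z => map_add (bilinExt m x) y z
    right_distrib := fun x y z => LinearMap.map_add₂ (bilinExt m) x y z
    zero_mul := fun x => LinearMap.map_zero₂ (bilinExt m) x
    mul_zero := fun x => map_zero (bilinExt m x)
    mul_assoc := fun x y z => by
      change bilinExt m (bilinExt m x y) z = bilinExt m x (bilinExt m y z)
      induction x using Finsupp.induction_linear with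
      | zero => simp
      | add x x' hx hx' => simp only [map_add, LinearMap.add_apply, hx, hx']
      | single i a =>
        induction y using Finsupp.induction_linear with
        | zero => simp
        | add y y' hy hy' => simp only [map_add, LinearMap.add_apply, hy, hy']
        | single j b =>
          induction z using Finsupp.induction_linear with
          | zero => simp
          | add z z' hz hz' => simp only [map_add, hz, hz']
          | single l c =>
            have hs : ∀ (i : ι) (a : k), Finsupp.single i a = a • Finsupp.single i (1 : k) := by
              intro i a; simp
            rw [hs i a, hs j b, hs l c]
            simp only [map_smul, LinearMap.smul_apply, bilinExt_single, hassoc]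
    one_mul := fun x => by
      change bilinExt m e x = x
      have h : bilinExt m e = LinearMap.id := by
        refine Finsupp.lhom_ext' fun i => LinearMap.ext_ring ?_
        simpa using hleft i
      rw [h, LinearMap.id_apply]
    mul_one := fun x => by
      change bilinExt m x e = x
      have h : (bilinExt m).flip e = LinearMap.id := by
        refine Finsupp.lhom_ext' fun i => LinearMap.ext_ring ?_
        simpa using hright i
      rw [← LinearMap.flip_apply, h, LinearMap.id_apply] }

end StructureConstants

/-! ## Groupoid algebras -/

section GroupoidAlgebra

open CategoryTheory

/-- The arrows of a category. -/
@[ext] structure Mor (C : Type*) [Category C] where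
  src : C
  tgt : C
  hom : src ⟶ tgt

/-- The composite `γ ∘ δ` (first `δ`, then `γ`). -/
def Mor.comp {C : Type*} [Category C] (γ δ : Mor C) (h : δ.tgt = γ.src) : Mor C :=
  ⟨δ.src, γ.tgt, δ.hom ≫ eqToHom h ≫ γ.hom⟩

open Classical in
/-- The product of two arrows in the groupoid algebra: their composite if they are composable,
zero otherwise. -/
def Mor.prod (k : Type*) {C : Type*} [Field k] [Category C] (γ δ : Mor C) : Mor C →₀ k :=
  if h : δ.tgt = γ.src then Finsupp.single (γ.comp δ h) 1 else 0

/-- The groupoid algebra: the vector space with the arrows as a basis. -/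
def GroupoidAlgebra (k C : Type*) [Field k] [Groupoid C] : Type _ := Mor C →₀ k

theorem Mor.comp_id {C : Type*} [Category C] (γ : Mor C) :
    γ.comp ⟨γ.src, γ.src, 𝟙 _⟩ rfl = γ := by
  rcases γ with ⟨a, b, f⟩; simp [Mor.comp]

theorem Mor.id_comp {C : Type*} [Category C] (γ : Mor C) :
    Mor.comp ⟨γ.tgt, γ.tgt, 𝟙 _⟩ γ rfl = γ := by
  rcases γ with ⟨a, b, f⟩; simp [Mor.comp]

/-- The unit of the algebra is the sum of the identities, which is finite since there are finitely
many objects. -/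
instance (k C : Type*) [Field k] [Groupoid C] [Fintype C] : Ring (GroupoidAlgebra k C) :=
  structRing (ι := Mor C) (Mor.prod k) (∑ x : C, Finsupp.single ⟨x, x, 𝟙 x⟩ 1)
    (by
      intro i j l
      by_cases h₁ : j.tgt = i.src
      · by_cases h₂ : l.tgt = j.src
        · have e₁ : l.tgt = (i.comp j h₁).src := h₂
          have e₂ : (j.comp l h₂).tgt = i.src := h₁
          have e₃ : (i.comp j h₁).comp l e₁ = i.comp (j.comp l h₂) e₂ := by
            simp [Mor.comp]
          rw [Mor.prod, dif_pos h₁, Mor.prod, dif_pos h₂, bilinExt_single, bilinExt_single,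
            Mor.prod, dif_pos e₁, Mor.prod, dif_pos e₂, e₃]
        · have e₁ : ¬ l.tgt = (i.comp j h₁).src := h₂
          simp [Mor.prod, h₁, h₂, bilinExt_single, e₁]
      · by_cases h₂ : l.tgt = j.src
        · have e₂ : ¬ (j.comp l h₂).tgt = i.src := h₁
          simp [Mor.prod, h₁, h₂, bilinExt_single, e₂]
        · simp [Mor.prod, h₁, h₂])
    (by
      intro i
      rw [map_sum, LinearMap.sum_apply, Finset.sum_eq_single i.tgt]
      · rw [bilinExt_single, Mor.prod, dif_pos rfl, Mor.id_comp]
      · intro b _ hb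
        rw [bilinExt_single, Mor.prod, dif_neg (fun h => hb h.symm)]
      · simp)
    (by
      intro i
      rw [map_sum, Finset.sum_eq_single i.src]
      · rw [bilinExt_single, Mor.prod, dif_pos rfl, Mor.comp_id]
      · intro b _ hb
        rw [bilinExt_single, Mor.prod, dif_neg hb]
      · simp)

instance (k C : Type*) [Field k] [Groupoid C] [Fintype C] : Module k (GroupoidAlgebra k C) :=
  inferInstanceAs (Module k (Mor C →₀ k))

instance (k C : Type*) [Field k] [Groupoid C] [Fintype C] : Algebra k (GroupoidAlgebra k C) :=
  Algebra.ofModule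
    (fun r x y => LinearMap.map_smul₂ (bilinExt (Mor.prod k (C := C))) r x y)
    (fun r x y => map_smul (bilinExt (Mor.prod k (C := C)) x) r y)

end GroupoidAlgebra

/-! ## Nonempty subsets of a finite group, the groupoid `Γ_glob(G)` and `k_glob G` -/

section Subsets

/-- The nonempty subsets of a finite group. -/
abbrev NESub (G : Type*) : Type _ := {X : Finset G // X.Nonempty}

/-- Nonempty subsets form a commutative semigroup under union. -/
instance (G : Type*) [DecidableEq G] : CommSemigroup (NESub G) where
  mul X Y := ⟨X.1 ∪ Y.1, X.2.mono Finset.subset_union_left⟩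
  mul_assoc X Y Z := Subtype.ext (Finset.union_assoc X.1 Y.1 Z.1)
  mul_comm X Y := Subtype.ext (Finset.union_comm X.1 Y.1)

/-- The group acts on nonempty subsets by left translation, `g • X = {g x | x ∈ X}`. -/
instance (G : Type*) [Group G] [DecidableEq G] : MulAction G (NESub G) where
  smul g X := ⟨g • X.1, X.2.smul_finset⟩
  one_smul X := Subtype.ext (one_smul G X.1)
  mul_smul g h X := Subtype.ext (mul_smul g h X.1)

theorem NESub.coe_mul {G : Type*} [DecidableEq G] (X Y : NESub G) :
    (X * Y).1 = X.1 ∪ Y.1 := rfl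

theorem NESub.coe_smul {G : Type*} [Group G] [DecidableEq G] (g : G) (X : NESub G) :
    (g • X).1 = g • X.1 := rfl

theorem NESub.smul_mul {G : Type*} [Group G] [DecidableEq G] (g : G) (X Y : NESub G) :
    g • (X * Y) = g • X * g • Y :=
  Subtype.ext (Finset.smul_finset_union (a := g) (s₁ := X.1) (s₂ := Y.1))

/-- The objects of the groupoid `Γ_glob(G)`. -/
@[ext] structure GammaGlob (G : Type*) where
  carrier : NESub G

instance (G : Type*) [Fintype G] [DecidableEq G] : Fintype (GammaGlob G) :=
  Fintype.ofEquiv (NESub G) ⟨GammaGlob.mk, GammaGlob.carrier, fun _ => rfl, fun _ => rfl⟩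

/-- The groupoid `Γ_glob(G)`: an arrow `A ⟶ B` is a pair `(g, A)` with `g A = B`, and
`(g, A) ∘ (h, B) = (g h, B)` whenever `A = h B`. -/
instance (G : Type*) [Group G] [DecidableEq G] : CategoryTheory.Groupoid (GammaGlob G) where
  Hom A B := {g : G // g • A.carrier = B.carrier}
  id A := ⟨1, one_smul G _⟩
  comp f g := ⟨g.1 * f.1, by rw [mul_smul, f.2, g.2]⟩
  inv f := ⟨f.1⁻¹, by rw [inv_smul_eq_iff, f.2]⟩
  id_comp f := Subtype.ext (mul_one f.1)
  comp_id f := Subtype.ext (one_mul f.1)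
  assoc f g h := Subtype.ext (mul_assoc h.1 g.1 f.1).symm
  inv_comp f := Subtype.ext (mul_inv_cancel f.1)
  comp_inv f := Subtype.ext (inv_mul_cancel f.1)

/-- `(g, A) (h, B) = (g h, B)` if `A = h B`, and `0` otherwise. -/
def kGlobProd (k : Type*) {G : Type*} [Field k] [Group G] [DecidableEq G]
    (p q : G × NESub G) : G × NESub G →₀ k :=
  if p.2 = q.1 • q.2 then Finsupp.single (p.1 * q.1, q.2) 1 else 0

/-- The algebra `k_glob G`, with basis the pairs `(g, A)`, `A` a nonempty subset of `G`. -/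
def KGlob (k G : Type*) [Field k] : Type _ := G × NESub G →₀ k

instance (k G : Type*) [Field k] [Group G] [Fintype G] [DecidableEq G] : Ring (KGlob k G) :=
  structRing (ι := G × NESub G) (kGlobProd k) (∑ A : NESub G, Finsupp.single (1, A) 1)
    (by
      rintro ⟨g, A⟩ ⟨h, B⟩ ⟨l, C⟩
      by_cases h₁ : A = h • B
      · by_cases h₂ : B = l • C
        · simp [kGlobProd, h₁, h₂, bilinExt_single, mul_assoc, mul_smul]
        · simp [kGlobProd, h₁, h₂, bilinExt_single]
      · by_cases h₂ : B = l • C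
        · have h₃ : ¬ A = (h * l) • C := by rwa [mul_smul, ← h₂]
          simp only [kGlobProd, if_neg h₁, if_pos h₂, bilinExt_single, if_neg h₃]
          simp
        · simp [kGlobProd, h₁, h₂])
    (by
      rintro ⟨g, A⟩
      rw [map_sum, LinearMap.sum_apply, Finset.sum_eq_single (g • A)]
      · simp [bilinExt_single, kGlobProd]
      · intro B _ hB
        simp [bilinExt_single, kGlobProd, hB]
      · simp)
    (by
      rintro ⟨g, A⟩
      rw [map_sum, Finset.sum_eq_single A]
      · simp [bilinExt_single, kGlobProd]
      · intro B _ hB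
        simp [bilinExt_single, kGlobProd, hB.symm]
      · simp)

instance (k G : Type*) [Field k] [Group G] [Fintype G] [DecidableEq G] : Module k (KGlob k G) :=
  inferInstanceAs (Module k (G × NESub G →₀ k))

instance (k G : Type*) [Field k] [Group G] [Fintype G] [DecidableEq G] : Algebra k (KGlob k G) :=
  Algebra.ofModule
    (fun r x y => LinearMap.map_smul₂ (bilinExt (kGlobProd k (G := G))) r x y)
    (fun r x y => map_smul (bilinExt (kGlobProd k (G := G)) x) r y)

end Subsets

/-! ## The algebra `B(G)` -/

section SemigroupAlgebra

/-- The semigroup algebra of the semigroup of nonempty subsets of `G` under union. -/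
def BAlg (k G : Type*) [Field k] : Type _ := MonoidAlgebra k (NESub G)

/-- The alternating sum of all nonempty subsets, which is the unit element of `B(G)`. -/
def bUnit (k G : Type*) [Field k] [Fintype G] [DecidableEq G] : MonoidAlgebra k (NESub G) :=
  ∑ Y : NESub G, MonoidAlgebra.single Y ((-1 : k) ^ (Y.1.card + 1))

theorem bUnit_mul_single (k : Type*) {G : Type*} [Field k] [Fintype G] [DecidableEq G]
    (X : NESub G) :
    bUnit k G * MonoidAlgebra.single X 1 = MonoidAlgebra.single X 1 := by
  obtain ⟨g, hg⟩ := X.2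
  have key : ∀ Y : NESub G, (symmDiff Y.1 {g}).Nonempty ∨ Y = ⟨{g}, Finset.singleton_nonempty g⟩ := by
    intro Y
    by_cases h : symmDiff Y.1 {g} = ∅
    · right
      have : symmDiff Y.1 {g} = ⊥ := h
      exact Subtype.ext (symmDiff_eq_bot.mp this)
    · exact Or.inl (Finset.nonempty_iff_ne_empty.mpr h)
  rw [bUnit, Finset.sum_mul,
    ← Finset.add_sum_erase _ _ (Finset.mem_univ (⟨{g}, Finset.singleton_nonempty g⟩ : NESub G))]
  have h0 : ∑ Y ∈ Finset.univ.erase (⟨{g}, Finset.singleton_nonempty g⟩ : NESub G),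
      MonoidAlgebra.single Y ((-1 : k) ^ (Y.1.card + 1)) * MonoidAlgebra.single X 1 = 0 := by
    refine Finset.sum_involution (fun Y hY => ⟨symmDiff Y.1 {g},
      (key Y).resolve_right (Finset.ne_of_mem_erase hY)⟩) ?_ ?_ ?_ ?_
    · intro Y hY
      have hu : (⟨symmDiff Y.1 {g}, (key Y).resolve_right (Finset.ne_of_mem_erase hY)⟩ :
          NESub G) * X = Y * X := by
        refine Subtype.ext ?_
        simp only [NESub.coe_mul]
        ext x
        by_cases hx : x = g
        · subst hx; simp [hg]
        · simp [Finset.mem_symmDiff, hx]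
      rw [MonoidAlgebra.single_mul_single, MonoidAlgebra.single_mul_single, hu,
        ← MonoidAlgebra.single_add]
      suffices h : (-1 : k) ^ (Y.1.card + 1) * 1 + (-1) ^ ((symmDiff Y.1 {g}).card + 1) * 1 = 0 by
        rw [h, MonoidAlgebra.single_zero]
      by_cases hgY : g ∈ Y.1
      · have e : symmDiff Y.1 {g} = Y.1.erase g := by
          ext x
          by_cases hx : x = g
          · subst hx; simp [Finset.mem_symmDiff, hgY]
          · simp [Finset.mem_symmDiff, hx]
        rw [e, ← Finset.card_erase_add_one hgY]
        ring
      · have e : symmDiff Y.1 {g} = insert g Y.1 := by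
          ext x
          by_cases hx : x = g
          · subst hx; simp [Finset.mem_symmDiff, hgY]
          · simp [Finset.mem_symmDiff, hx]
        rw [e, Finset.card_insert_of_notMem hgY]
        ring
    · intro Y hY _ h
      have h' : symmDiff Y.1 {g} = Y.1 := congrArg Subtype.val h
      rw [symmDiff_eq_left] at h'
      exact Finset.singleton_ne_empty g h'
    · intro Y hY
      refine Finset.mem_erase.mpr ⟨fun h => ?_, Finset.mem_univ _⟩
      have h' : symmDiff Y.1 {g} = {g} := congrArg Subtype.val h
      rw [symmDiff_eq_right] at h'
      exact Y.2.ne_empty h'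
    · intro Y hY
      exact Subtype.ext (symmDiff_symmDiff_cancel_right _ _)
  rw [h0, add_zero, MonoidAlgebra.single_mul_single]
  have : (⟨{g}, Finset.singleton_nonempty g⟩ : NESub G) * X = X :=
    Subtype.ext (by rw [NESub.coe_mul]; simpa using hg)
  rw [this]; simp

theorem bUnit_mul {k G : Type*} [Field k] [Fintype G] [DecidableEq G]
    (x : MonoidAlgebra k (NESub G)) : bUnit k G * x = x := by
  induction x using MonoidAlgebra.induction_linear with
  | zero => simp
  | add x y hx hy => rw [mul_add, hx, hy]
  | single X a =>
    have h : MonoidAlgebra.single X a = a • MonoidAlgebra.single X (1 : k) := by simp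
    rw [h, mul_smul_comm, bUnit_mul_single]

instance (k G : Type*) [Field k] [Fintype G] [DecidableEq G] : CommRing (BAlg k G) :=
  { (inferInstance : NonUnitalCommRing (MonoidAlgebra k (NESub G))) with
    one := bUnit k G
    one_mul := bUnit_mul
    mul_one := fun x =>
      (mul_comm (show MonoidAlgebra k (NESub G) from x) (bUnit k G)).trans (bUnit_mul x) }

instance (k G : Type*) [Field k] [Fintype G] [DecidableEq G] : Module k (BAlg k G) :=
  inferInstanceAs (Module k (MonoidAlgebra k (NESub G)))

instance (k G : Type*) [Field k] [Fintype G] [DecidableEq G] : Algebra k (BAlg k G) :=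
  Algebra.ofModule
    (fun r x y => smul_mul_assoc r (show MonoidAlgebra k (NESub G) from x) y)
    (fun r x y => mul_smul_comm r (show MonoidAlgebra k (NESub G) from x) y)

/-- The class in `B(G)` of a nonempty subset. -/
def bOf (k : Type*) {G : Type*} [Field k] (X : NESub G) : BAlg k G :=
  MonoidAlgebra.single X 1

theorem bOf_mul (k : Type*) {G : Type*} [Field k] [Fintype G] [DecidableEq G] (X Y : NESub G) :
    bOf k X * bOf k Y = bOf k (X * Y) := by
  have h := MonoidAlgebra.single_mul_single (R := k) X Y 1 1
  rw [mul_one] at h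
  exact h

/-- The linear extension to `B(G)` of left translation of subsets. -/
def bAct (k : Type*) {G : Type*} [Field k] [Group G] [Fintype G] [DecidableEq G] (g : G) :
    BAlg k G →ₗ[k] BAlg k G where
  toFun x := MonoidAlgebra.mapDomain (g • ·) x
  map_add' x y := MonoidAlgebra.mapDomain_add (g • ·) x y
  map_smul' a x := MonoidAlgebra.mapDomain_smul (g • ·) a x

theorem bAct_of (k : Type*) {G : Type*} [Field k] [Group G] [Fintype G] [DecidableEq G] (g : G)
    (X : NESub G) : bAct k g (bOf k X) = bOf k (g • X) :=
  MonoidAlgebra.mapDomain_single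

theorem bLhom_ext {k G V : Type*} [Field k] [Fintype G] [DecidableEq G] [AddCommGroup V]
    [Module k V] {f f' : BAlg k G →ₗ[k] V} (h : ∀ X, f (bOf k X) = f' (bOf k X)) : f = f' :=
  (MonoidAlgebra.basis (NESub G) k).ext
    (f₁ := (f : MonoidAlgebra k (NESub G) →ₗ[k] V)) (f₂ := f') (fun X => h X)

theorem bAct_mul {k G : Type*} [Field k] [Group G] [Fintype G] [DecidableEq G] (g : G)
    (x y : BAlg k G) : bAct k g (x * y) = bAct k g x * bAct k g y := by
  have h : (LinearMap.mul k (BAlg k G)).compr₂ (bAct k g)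
      = (LinearMap.mul k (BAlg k G)).compl₁₂ (bAct k g) (bAct k g) := by
    refine bLhom_ext fun X => bLhom_ext fun Y => ?_
    simp [bOf_mul, bAct_of, NESub.smul_mul]
  exact LinearMap.congr_fun₂ h x y

theorem bAct_bAct {k G : Type*} [Field k] [Group G] [Fintype G] [DecidableEq G] (g h : G)
    (x : BAlg k G) : bAct k g (bAct k h x) = bAct k (g * h) x := by
  have e : bAct k g ∘ₗ bAct k h = bAct k (g * h) := by
    refine bLhom_ext fun X => ?_
    simp [bAct_of, mul_smul]
  exact LinearMap.congr_fun e x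

theorem bAct_one {k G : Type*} [Field k] [Group G] [Fintype G] [DecidableEq G]
    (x : BAlg k G) : bAct k (1 : G) x = x := by
  have e : bAct k (1 : G) = LinearMap.id := by
    refine bLhom_ext fun X => ?_
    simp [bAct_of]
  exact LinearMap.congr_fun e x

/-- `G` acts on `B(G)` by algebra automorphisms, through left translation of subsets. -/
instance (k G : Type*) [Field k] [Group G] [Fintype G] [DecidableEq G] :
    MulSemiringAction G (BAlg k G) where
  smul g x := bAct k g x
  one_smul x := bAct_one x
  mul_smul g h x := (bAct_bAct g h x).symm
  smul_zero g := map_zero (bAct k g)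
  smul_add g := map_add (bAct k g)
  smul_mul g x y := bAct_mul g x y
  smul_one g := by
    change bAct k g 1 = 1
    calc bAct k g 1 = bAct k g 1 * bAct k g (bAct k g⁻¹ 1) := by
          rw [bAct_bAct, mul_inv_cancel, bAct_one, mul_one]
      _ = 1 := by rw [← bAct_mul, one_mul, bAct_bAct, mul_inv_cancel, bAct_one]

instance (k G : Type*) [Field k] [Group G] [Fintype G] [DecidableEq G] :
    SMulCommClass G k (BAlg k G) where
  smul_comm g a x := map_smul (bAct k g) a x

/-- The basis of orthogonal idempotents of `B(G)`, obtained from the subsets by Möbius inversion: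
`Q_X = ∑_{Y ⊇ X} (-1)^{|Y| - |X|} Y`, so that `X = ∑_{Y ⊇ X} Q_Y`. -/
def bQ (k : Type*) {G : Type*} [Field k] [Fintype G] [DecidableEq G] (X : NESub G) : BAlg k G :=
  ∑ Y : NESub G with X.1 ⊆ Y.1, (-1 : k) ^ (Y.1.card - X.1.card) • bOf k Y

/-- The action of `G` permutes the idempotents `Q_X`: `g • Q_X = Q_{gX}`. -/
theorem smul_bQ (k : Type*) {G : Type*} [Field k] [Group G] [Fintype G] [DecidableEq G]
    (g : G) (X : NESub G) : g • bQ k X = bQ k (g • X) := by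
  change bAct k g (bQ k X) = _
  rw [bQ, map_sum, bQ]
  refine Finset.sum_equiv (MulAction.toPerm g) ?_ ?_
  · intro Y
    simp [NESub.coe_smul, Finset.smul_finset_subset_smul_finset_iff]
  · intro Y _
    rw [map_smul, bAct_of]
    simp [NESub.coe_smul, Finset.card_smul_finset]

end SemigroupAlgebra

/-! ## Smash products with a group algebra -/

section Smash

/-- The smash product `A # kG` of a `kG`-module algebra `A` with the group algebra `kG`: the
vector space `A ⊗ kG` with the product `(a # g) (b # h) = a (g • b) # g h`. -/
def Smash (k G A : Type*) [Field k] [Group G] [Ring A] [Algebra k A] : Type _ :=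
  A ⊗[k] MonoidAlgebra k G

instance (k G A : Type*) [Field k] [Group G] [Ring A] [Algebra k A] :
    AddCommGroup (Smash k G A) :=
  inferInstanceAs (AddCommGroup (A ⊗[k] MonoidAlgebra k G))

/-- The element `a # g`. -/
def Smash.mk (k : Type*) {G A : Type*} [Field k] [Group G] [Ring A] [Algebra k A] (a : A) (g : G) :
    Smash k G A :=
  a ⊗ₜ[k] MonoidAlgebra.single g 1

/-- Left multiplication by `a # g`. -/
def Smash.leftMul (k : Type*) {G A : Type*} [Field k] [Group G] [Ring A] [Algebra k A]
    [MulSemiringAction G A] [SMulCommClass G k A] (g : G) :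
    A →ₗ[k] (A ⊗[k] MonoidAlgebra k G) →ₗ[k] (A ⊗[k] MonoidAlgebra k G) where
  toFun a := TensorProduct.map (LinearMap.mulLeft k a ∘ₗ DistribSMul.toLinearMap k A g)
    (LinearMap.mulLeft k (MonoidAlgebra.single g 1))
  map_add' a b := by ext; simp [add_mul, TensorProduct.add_tmul]
  map_smul' r a := by ext; simp [TensorProduct.smul_tmul']

/-- The product of the smash product as a bilinear map. -/
def Smash.mulMap (k G A : Type*) [Field k] [Group G] [Ring A] [Algebra k A]
    [MulSemiringAction G A] [SMulCommClass G k A] :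
    (A ⊗[k] MonoidAlgebra k G) →ₗ[k] (A ⊗[k] MonoidAlgebra k G) →ₗ[k]
      (A ⊗[k] MonoidAlgebra k G) :=
  TensorProduct.lift ((MonoidAlgebra.basis G k).constr k (Smash.leftMul k)).flip

theorem Smash.mulMap_tmul (k : Type*) {G A : Type*} [Field k] [Group G] [Ring A] [Algebra k A]
    [MulSemiringAction G A] [SMulCommClass G k A] (a b : A) (g h : G) :
    Smash.mulMap k G A (a ⊗ₜ MonoidAlgebra.single g 1) (b ⊗ₜ MonoidAlgebra.single h 1)
      = (a * g • b) ⊗ₜ MonoidAlgebra.single (g * h) 1 := by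
  have e : (MonoidAlgebra.basis G k).constr k (Smash.leftMul k (A := A))
      (MonoidAlgebra.single g 1) = Smash.leftMul k g := by
    rw [← MonoidAlgebra.basis_apply, Module.Basis.constr_basis]
  simp only [Smash.mulMap, TensorProduct.lift.tmul, LinearMap.flip_apply, e]
  simp [Smash.leftMul, MonoidAlgebra.single_mul_single]

theorem Smash.lhom_ext {k G A V : Type*} [Field k] [Group G] [Ring A] [Algebra k A]
    [AddCommGroup V] [Module k V] {f f' : (A ⊗[k] MonoidAlgebra k G) →ₗ[k] V}
    (h : ∀ (a : A) (g : G), f (a ⊗ₜ MonoidAlgebra.single g 1) = f' (a ⊗ₜ MonoidAlgebra.single g 1)) :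
    f = f' := by
  refine TensorProduct.ext (LinearMap.ext fun a => ?_)
  refine (MonoidAlgebra.basis G k).ext fun g => ?_
  simpa using h a g

instance (k G A : Type*) [Field k] [Group G] [Ring A] [Algebra k A]
    [MulSemiringAction G A] [SMulCommClass G k A] : Ring (Smash k G A) :=
  { (inferInstance : AddCommGroup (Smash k G A)) with
    mul := fun x y => Smash.mulMap k G A x y
    one := Smash.mk k 1 1
    left_distrib := fun x y z => map_add (Smash.mulMap k G A x) y z
    right_distrib := fun x y z => LinearMap.map_add₂ (Smash.mulMap k G A) x y z
    zero_mul := fun x => LinearMap.map_zero₂ (Smash.mulMap k G A) x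
    mul_zero := fun x => map_zero (Smash.mulMap k G A x)
    mul_assoc := fun x y z => by
      have e : (Smash.mulMap k G A).compr₂ (Smash.mulMap k G A)
          = ((LinearMap.llcomp k _ _ _).flip ∘ₗ Smash.mulMap k G A).flip ∘ₗ Smash.mulMap k G A := by
        refine Smash.lhom_ext fun a g => Smash.lhom_ext fun b h => Smash.lhom_ext fun c l => ?_
        simp [Smash.mulMap_tmul, mul_assoc, mul_smul]
      exact LinearMap.congr_fun (LinearMap.congr_fun₂ e x y) z
    one_mul := fun x => by
      have e : Smash.mulMap k G A (Smash.mk k 1 1) = LinearMap.id := by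
        refine Smash.lhom_ext fun a g => ?_
        simp [Smash.mk, Smash.mulMap_tmul]
      exact LinearMap.congr_fun e x
    mul_one := fun x => by
      have e : (Smash.mulMap k G A).flip (Smash.mk k 1 1) = LinearMap.id := by
        refine Smash.lhom_ext fun a g => ?_
        simp [Smash.mk, Smash.mulMap_tmul]
      exact LinearMap.congr_fun e x }

instance (k G A : Type*) [Field k] [Group G] [Ring A] [Algebra k A]
    [MulSemiringAction G A] [SMulCommClass G k A] : Module k (Smash k G A) :=
  inferInstanceAs (Module k (A ⊗[k] MonoidAlgebra k G))

instance (k G A : Type*) [Field k] [Group G] [Ring A] [Algebra k A]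
    [MulSemiringAction G A] [SMulCommClass G k A] : Algebra k (Smash k G A) :=
  Algebra.ofModule
    (fun r x y => LinearMap.map_smul₂ (Smash.mulMap k G A) r x y)
    (fun r x y => map_smul (Smash.mulMap k G A x) r y)

theorem Smash.mk_mul_mk (k : Type*) {G A : Type*} [Field k] [Group G] [Ring A] [Algebra k A]
    [MulSemiringAction G A] [SMulCommClass G k A] (a b : A) (g h : G) :
    Smash.mk k a g * Smash.mk k b h = Smash.mk k (a * g • b) (g * h) :=
  Smash.mulMap_tmul k a b g h

end Smash

/-! ## Partial representations: `k_par G` and `A_par(G)` -/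

section Partial

/-- The defining relations of `k_par G` on generators `[g]`: `[1] = 1`,
`[g][h][h⁻¹] = [gh][h⁻¹]` and `[g⁻¹][g][h] = [g⁻¹][gh]`. -/
inductive ParRel (k G : Type*) [Field k] [Group G] : FreeAlgebra k G → FreeAlgebra k G → Prop
  | one : ParRel k G (FreeAlgebra.ι k 1) 1
  | right (g h : G) : ParRel k G (FreeAlgebra.ι k g * FreeAlgebra.ι k h * FreeAlgebra.ι k h⁻¹)
      (FreeAlgebra.ι k (g * h) * FreeAlgebra.ι k h⁻¹)
  | left (g h : G) : ParRel k G (FreeAlgebra.ι k g⁻¹ * FreeAlgebra.ι k g * FreeAlgebra.ι k h)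
      (FreeAlgebra.ι k g⁻¹ * FreeAlgebra.ι k (g * h))

/-- The partial group algebra `k_par G`. -/
def KPar (k G : Type*) [Field k] [Group G] : Type _ := RingQuot (ParRel k G)

instance (k G : Type*) [Field k] [Group G] : Ring (KPar k G) :=
  inferInstanceAs (Ring (RingQuot (ParRel k G)))

instance (k G : Type*) [Field k] [Group G] : Algebra k (KPar k G) :=
  inferInstanceAs (Algebra k (RingQuot (ParRel k G)))

/-- The generator `[g]` of `k_par G`. -/
def br (k : Type*) {G : Type*} [Field k] [Group G] (g : G) : KPar k G :=
  RingQuot.mkAlgHom k (ParRel k G) (FreeAlgebra.ι k g)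

theorem br_one (k G : Type*) [Field k] [Group G] : br k (1 : G) = 1 := by
  have h := RingQuot.mkAlgHom_rel k (ParRel.one (k := k) (G := G))
  rw [map_one] at h
  exact h

theorem br_right (k : Type*) {G : Type*} [Field k] [Group G] (g h : G) :
    br k g * br k h * br k h⁻¹ = br k (g * h) * br k h⁻¹ := by
  have e := RingQuot.mkAlgHom_rel k (ParRel.right (k := k) g h)
  simp only [map_mul] at e
  exact e

theorem br_left (k : Type*) {G : Type*} [Field k] [Group G] (g h : G) :
    br k g⁻¹ * br k g * br k h = br k g⁻¹ * br k (g * h) := by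
  have e := RingQuot.mkAlgHom_rel k (ParRel.left (k := k) g h)
  simp only [map_mul] at e
  exact e

/-- `ε_g = [g][g⁻¹]`. -/
def eps (k : Type*) {G : Type*} [Field k] [Group G] (g : G) : KPar k G := br k g * br k g⁻¹

/-- `A_par(G)`, the subalgebra of `k_par G` generated by the elements `ε_g`. -/
def Apar (k G : Type*) [Field k] [Group G] : Subalgebra k (KPar k G) :=
  Algebra.adjoin k (Set.range (eps k))

theorem eps_mem (k : Type*) {G : Type*} [Field k] [Group G] (g : G) : eps k g ∈ Apar k G :=
  Algebra.subset_adjoin ⟨g, rfl⟩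

theorem br_right' (k : Type*) {G : Type*} [Field k] [Group G] (g h : G) :
    br k g * br k h⁻¹ * br k h = br k (g * h⁻¹) * br k h := by
  simpa using br_right k g h⁻¹

theorem br_left' (k : Type*) {G : Type*} [Field k] [Group G] (g h : G) :
    br k g * br k g⁻¹ * br k h = br k g * br k (g⁻¹ * h) := by
  simpa using br_left k g⁻¹ h

theorem br_inv_br (k : Type*) {G : Type*} [Field k] [Group G] (g : G) :
    br k g * br k g⁻¹ * br k g = br k g := by
  rw [br_right', mul_inv_cancel, br_one, one_mul]

theorem br_mul_eps (k : Type*) {G : Type*} [Field k] [Group G] (g h : G) :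
    br k g * eps k h = eps k (g * h) * br k g := by
  have h1 : br k (g * h)⁻¹ * br k (g * h) * br k h⁻¹ = br k (g * h)⁻¹ * br k g := by
    rw [br_left, mul_inv_cancel_right]
  calc br k g * eps k h = br k (g * h) * br k h⁻¹ := by
        rw [eps, ← mul_assoc, br_right]
    _ = br k (g * h) * (br k (g * h)⁻¹ * br k (g * h) * br k h⁻¹) := by
        rw [← mul_assoc, ← mul_assoc, br_inv_br]
    _ = eps k (g * h) * br k g := by rw [h1, ← mul_assoc, eps]

theorem eps_mul_br (k : Type*) {G : Type*} [Field k] [Group G] (g h : G) :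
    eps k h * br k g = br k g * eps k (g⁻¹ * h) := by
  rw [br_mul_eps, mul_inv_cancel_left]

theorem eps_comm (k : Type*) {G : Type*} [Field k] [Group G] (g h : G) :
    eps k g * eps k h = eps k h * eps k g := by
  conv_lhs => rw [eps, mul_assoc, br_mul_eps, ← mul_assoc, br_mul_eps, mul_inv_cancel_left,
    mul_assoc]
  rfl

theorem eps_comm_Apar {k G : Type*} [Field k] [Group G] (g : G) {a : KPar k G}
    (ha : a ∈ Apar k G) : eps k g * a = a * eps k g := by
  induction ha using Algebra.adjoin_induction with
  | mem x hx => obtain ⟨h, rfl⟩ := hx; exact eps_comm k g h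
  | algebraMap r => exact (Algebra.commutes r _).symm
  | add x y _ _ hx hy => rw [mul_add, add_mul, hx, hy]
  | mul x y _ _ hx hy => rw [← mul_assoc, hx, mul_assoc, hy, mul_assoc]

/-- `[g⁻¹][g] = ε_{g⁻¹}`. -/
theorem br_inv_mul_br (k : Type*) {G : Type*} [Field k] [Group G] (g : G) :
    br k g⁻¹ * br k g = eps k g⁻¹ := by
  rw [eps, inv_inv]

/-- `[g] a b [g⁻¹] = ([g] a [g⁻¹]) ([g] b [g⁻¹])` for `a` in `A_par(G)`. -/
theorem conj_mul {k G : Type*} [Field k] [Group G] (g : G) {a b : KPar k G}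
    (ha : a ∈ Apar k G) :
    br k g * (a * b) * br k g⁻¹ = br k g * a * br k g⁻¹ * (br k g * b * br k g⁻¹) := by
  have h1 : br k g * eps k g⁻¹ = br k g := by
    rw [← br_inv_mul_br, ← mul_assoc, br_inv_br]
  calc br k g * (a * b) * br k g⁻¹ = br k g * eps k g⁻¹ * (a * b) * br k g⁻¹ := by rw [h1]
    _ = br k g * (eps k g⁻¹ * a) * b * br k g⁻¹ := by simp only [mul_assoc]
    _ = br k g * a * (br k g⁻¹ * br k g) * b * br k g⁻¹ := by
        rw [eps_comm_Apar _ ha, br_inv_mul_br]; simp only [mul_assoc]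
    _ = _ := by simp only [mul_assoc]

theorem conj_mem {k G : Type*} [Field k] [Group G] (g : G) {a : KPar k G}
    (ha : a ∈ Apar k G) : br k g * a * br k g⁻¹ ∈ Apar k G := by
  induction ha using Algebra.adjoin_induction with
  | mem x hx =>
    obtain ⟨h, rfl⟩ := hx
    rw [br_mul_eps, mul_assoc]
    exact mul_mem (eps_mem k _) (eps_mem k g)
  | algebraMap r =>
    rw [← Algebra.commutes, mul_assoc]
    exact mul_mem (Subalgebra.algebraMap_mem _ r) (eps_mem k g)
  | add x y _ _ hx hy => rw [mul_add, add_mul]; exact add_mem hx hy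
  | mul x y hx' _ hx hy => rw [conj_mul g hx']; exact mul_mem hx hy

/-- A partial `kG`-module: a vector space `M` with a partial representation of `G`,
`g ↦ (g • ·)`, on it. -/
class PartialModule (k G M : Type*) [Field k] [Group G] [AddCommGroup M] [Module k M] where
  /-- The partial action of a group element. -/
  act : G → M →ₗ[k] M
  act_one : ∀ m, act 1 m = m
  act_right : ∀ (g h : G) (m : M), act g (act h (act h⁻¹ m)) = act (g * h) (act h⁻¹ m)
  act_left : ∀ (g h : G) (m : M), act g⁻¹ (act g (act h m)) = act g⁻¹ (act (g * h) m)

/-- The partial action of `kG` on `A_par(G)`: `g • a = [g] a [g⁻¹]`. -/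
instance (k G : Type*) [Field k] [Group G] : PartialModule k G (Apar k G) where
  act g :=
    { toFun := fun a => ⟨br k g * a.1 * br k g⁻¹, conj_mem g a.2⟩
      map_add' := fun a b => Subtype.ext (by simp [mul_add, add_mul])
      map_smul' := fun r a => Subtype.ext (by simp) }
  act_one a := Subtype.ext (by simp [br_one])
  act_right g h a := Subtype.ext (by
    have e1 := br_right k g h
    have e2 := br_left' k h g⁻¹
    simp only [LinearMap.coe_mk, AddHom.coe_mk, inv_inv, mul_inv_rev]
    calc br k g * (br k h * (br k h⁻¹ * a.1 * br k h) * br k h⁻¹) * br k g⁻¹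
        = (br k g * br k h * br k h⁻¹) * a.1 * (br k h * br k h⁻¹ * br k g⁻¹) := by
          simp only [mul_assoc]
      _ = _ := by rw [e1, e2]; simp only [mul_assoc])
  act_left g h a := Subtype.ext (by
    have e1 := br_left k g h
    have e2 := br_right' k h⁻¹ g
    simp only [LinearMap.coe_mk, AddHom.coe_mk, inv_inv, mul_inv_rev]
    calc br k g⁻¹ * (br k g * (br k h * a.1 * br k h⁻¹) * br k g⁻¹) * br k g
        = (br k g⁻¹ * br k g * br k h) * a.1 * (br k h⁻¹ * br k g⁻¹ * br k g) := by
          simp only [mul_assoc]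
      _ = _ := by rw [e1, e2]; simp only [mul_assoc])

theorem coe_act_Apar {k G : Type*} [Field k] [Group G] (g : G) (a : Apar k G) :
    (PartialModule.act (k := k) g a : Apar k G).1 = br k g * a.1 * br k g⁻¹ := rfl

end Partial

/-! ## The standard dilation -/

section Dilation

/-- The partial action of `g` extended linearly to `kG`. -/
def actLin (k G M : Type*) [Field k] [Group G] [AddCommGroup M] [Module k M]
    [PartialModule k G M] : MonoidAlgebra k G →ₗ[k] M →ₗ[k] M :=
  (MonoidAlgebra.basis G k).constr k (PartialModule.act (k := k) (M := M))

theorem actLin_single {k G M : Type*} [Field k] [Group G] [AddCommGroup M] [Module k M]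
    [PartialModule k G M] (g : G) :
    actLin k G M (MonoidAlgebra.single g 1) = PartialModule.act g := by
  rw [← MonoidAlgebra.basis_apply, actLin, Module.Basis.constr_basis]

/-- The action of `g` on `Hom_k(kG, M)`: `(g ⇀ f)(x) = f (x g)`. -/
def homAct {k G M : Type*} [Field k] [Group G] [AddCommGroup M] [Module k M] (g : G) :
    (MonoidAlgebra k G →ₗ[k] M) →ₗ[k] (MonoidAlgebra k G →ₗ[k] M) :=
  LinearMap.lcomp k M (LinearMap.mulRight k (MonoidAlgebra.single g 1))

/-- `φ : M → Hom_k(kG, M)`, `φ(m)(x) = x • m`. -/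
def dilPhi (k G : Type*) {M : Type*} [Field k] [Group G] [AddCommGroup M] [Module k M]
    [PartialModule k G M] : M →ₗ[k] (MonoidAlgebra k G →ₗ[k] M) :=
  (actLin k G M).flip

/-- The standard dilation of a partial `kG`-module `M`: the `kG`-submodule of `Hom_k(kG, M)`
generated by `φ(M)`. -/
def stdDilation (k G M : Type*) [Field k] [Group G] [AddCommGroup M] [Module k M]
    [PartialModule k G M] : Submodule k (MonoidAlgebra k G →ₗ[k] M) :=
  Submodule.span k {f | ∃ (g : G) (m : M), f = homAct g (dilPhi k G m)}

theorem homAct_single {k G M : Type*} [Field k] [Group G] [AddCommGroup M] [Module k M]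
    (g h : G) (f : MonoidAlgebra k G →ₗ[k] M) :
    homAct g f (MonoidAlgebra.single h 1) = f (MonoidAlgebra.single (h * g) 1) := by
  simp [homAct, MonoidAlgebra.single_mul_single]

theorem homAct_dilPhi_single {k G M : Type*} [Field k] [Group G] [AddCommGroup M] [Module k M]
    [PartialModule k G M] (g h : G) (m : M) :
    homAct g (dilPhi k G m) (MonoidAlgebra.single h 1) = PartialModule.act (k := k) (h * g) m := by
  rw [homAct_single, dilPhi, LinearMap.flip_apply, actLin_single]

theorem kG_ext {k G V : Type*} [Field k] [AddCommGroup V] [Module k V]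
    {f f' : MonoidAlgebra k G →ₗ[k] V}
    (h : ∀ g : G, f (MonoidAlgebra.single g 1) = f' (MonoidAlgebra.single g 1)) : f = f' :=
  (MonoidAlgebra.basis G k).ext fun g => by simpa using h g

theorem homAct_mem {k G M : Type*} [Field k] [Group G] [AddCommGroup M] [Module k M]
    [PartialModule k G M] (g : G) {f : MonoidAlgebra k G →ₗ[k] M} (hf : f ∈ stdDilation k G M) :
    homAct g f ∈ stdDilation k G M := by
  induction hf using Submodule.span_induction with
  | mem x hx =>
    obtain ⟨h, m, rfl⟩ := hx
    refine Submodule.subset_span ⟨g * h, m, kG_ext fun x => ?_⟩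
    rw [homAct_single, homAct_dilPhi_single, homAct_dilPhi_single, mul_assoc]
  | zero => rw [map_zero]; exact zero_mem _
  | add x y _ _ hx hy => rw [map_add]; exact add_mem hx hy
  | smul r x _ hx => rw [map_smul]; exact Submodule.smul_mem _ r hx

theorem conv_single {k G A : Type*} [Field k] [Group G] [Ring A] [Algebra k A]
    (f f' : WithConv (MonoidAlgebra k G →ₗ[k] A)) (g : G) :
    (f * f').ofConv (MonoidAlgebra.single g 1)
      = f.ofConv (MonoidAlgebra.single g 1) * f'.ofConv (MonoidAlgebra.single g 1) := by
  rw [LinearMap.convMul_apply]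
  simp

theorem convOne_single {k G A : Type*} [Field k] [Group G] [Ring A] [Algebra k A] (g : G) :
    (1 : WithConv (MonoidAlgebra k G →ₗ[k] A)).ofConv (MonoidAlgebra.single g 1) = 1 := by
  rw [LinearMap.convOne_apply]
  simp

theorem conv_ext {k G V : Type*} [Field k] [AddCommGroup V] [Module k V]
    {f f' : WithConv (MonoidAlgebra k G →ₗ[k] V)}
    (h : ∀ g : G, f.ofConv (MonoidAlgebra.single g 1) = f'.ofConv (MonoidAlgebra.single g 1)) :
    f = f' :=
  WithConv.ext (kG_ext h)

theorem act_mul_act {k G : Type*} [Field k] [Group G] (g h : G) (a b : Apar k G) :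
    (PartialModule.act (k := k) g (a * PartialModule.act (k := k) (g⁻¹ * h) b) : Apar k G)
      = PartialModule.act (k := k) g a * PartialModule.act (k := k) h b := by
  refine Subtype.ext ?_
  simp only [Subalgebra.coe_mul, coe_act_Apar]
  rw [conj_mul g a.2, mul_inv_rev, inv_inv]
  have e1 : br k g * br k (g⁻¹ * h) = eps k g * br k h := by rw [eps, br_left']
  have e2 : br k (h⁻¹ * g) * br k g⁻¹ = br k h⁻¹ * eps k g := by
    rw [eps, ← mul_assoc, ← br_right k h⁻¹ g]
  have hb : br k h * b.1 * br k h⁻¹ ∈ Apar k G := conj_mem h b.2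
  have hg : br k g * eps k g⁻¹ = br k g := by
    rw [← br_inv_mul_br, ← mul_assoc, br_inv_br]
  have hg' : br k g⁻¹ * eps k g = br k g⁻¹ := by
    have := br_inv_br k g⁻¹
    rwa [inv_inv, mul_assoc] at this
  calc br k g * a.1 * br k g⁻¹ * (br k g * (br k (g⁻¹ * h) * b.1 * br k (h⁻¹ * g)) * br k g⁻¹)
      = br k g * a.1 * br k g⁻¹ * ((br k g * br k (g⁻¹ * h)) * b.1
          * (br k (h⁻¹ * g) * br k g⁻¹)) := by simp only [mul_assoc]
    _ = br k g * a.1 * br k g⁻¹ * (eps k g * ((br k h * b.1 * br k h⁻¹) * eps k g)) := by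
        rw [e1, e2]; simp only [mul_assoc]
    _ = br k g * a.1 * (br k g⁻¹ * eps k g * eps k g) * (br k h * b.1 * br k h⁻¹) := by
        rw [← eps_comm_Apar g hb]; simp only [mul_assoc]
    _ = _ := by rw [hg', hg']

theorem stdDilation_mul_mem {k G : Type*} [Field k] [Group G]
    {f f' : WithConv (MonoidAlgebra k G →ₗ[k] Apar k G)}
    (hf : f.ofConv ∈ stdDilation k G (Apar k G)) (hf' : f'.ofConv ∈ stdDilation k G (Apar k G)) :
    (f * f').ofConv ∈ stdDilation k G (Apar k G) := by
  obtain ⟨f⟩ := f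
  obtain ⟨f'⟩ := f'
  change f ∈ stdDilation k G (Apar k G) at hf
  change f' ∈ stdDilation k G (Apar k G) at hf'
  induction hf using Submodule.span_induction with
  | mem x hx =>
    obtain ⟨g, a, rfl⟩ := hx
    induction hf' using Submodule.span_induction with
    | mem y hy =>
      obtain ⟨h, b, rfl⟩ := hy
      refine Submodule.subset_span ⟨g, a * PartialModule.act (k := k) (g⁻¹ * h) b,
        kG_ext fun x => ?_⟩
      have e : (x * g)⁻¹ * (x * h) = g⁻¹ * h := by group
      rw [conv_single, homAct_dilPhi_single, homAct_dilPhi_single, homAct_dilPhi_single,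
        ← act_mul_act, e]
    | zero =>
      rw [WithConv.toConv_zero, mul_zero, WithConv.ofConv_zero]; exact zero_mem _
    | add y z _ _ hy hz =>
      rw [WithConv.toConv_add, mul_add, WithConv.ofConv_add]; exact add_mem hy hz
    | smul r y _ hy =>
      rw [WithConv.toConv_smul, mul_smul_comm, WithConv.ofConv_smul]
      exact Submodule.smul_mem _ r hy
  | zero =>
    rw [WithConv.toConv_zero, zero_mul, WithConv.ofConv_zero]; exact zero_mem _
  | add y z _ _ hy hz =>
    rw [WithConv.toConv_add, add_mul, WithConv.ofConv_add]; exact add_mem hy hz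
  | smul r y _ hy =>
    rw [WithConv.toConv_smul, smul_mul_assoc, WithConv.ofConv_smul]
    exact Submodule.smul_mem _ r hy

/-- As `G` is finite, the unit of the convolution algebra lies in the standard dilation. -/
theorem stdDilation_one_mem (k G : Type*) [Field k] [Group G] [Fintype G] :
    (1 : WithConv (MonoidAlgebra k G →ₗ[k] Apar k G)).ofConv ∈ stdDilation k G (Apar k G) := by
  have key : ∀ l : List G, ∃ d : WithConv (MonoidAlgebra k G →ₗ[k] Apar k G),
      d.ofConv ∈ stdDilation k G (Apar k G) ∧
      ∀ x : G, x⁻¹ ∈ l → d.ofConv (MonoidAlgebra.single x 1) = 1 := by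
    intro l
    induction l with
    | nil => exact ⟨0, zero_mem _, by simp⟩
    | cons g l ih =>
      obtain ⟨d, hd, hd'⟩ := ih
      set s : WithConv (MonoidAlgebra k G →ₗ[k] Apar k G) :=
        WithConv.toConv (homAct g (dilPhi k G 1)) with hs
      have hsm : s.ofConv ∈ stdDilation k G (Apar k G) := Submodule.subset_span ⟨g, 1, rfl⟩
      refine ⟨d + s - d * s, ?_, fun x hx => ?_⟩
      · rw [WithConv.ofConv_sub, WithConv.ofConv_add]
        exact sub_mem (add_mem hd hsm) (stdDilation_mul_mem hd hsm)
      · rw [WithConv.ofConv_sub, WithConv.ofConv_add, LinearMap.sub_apply, LinearMap.add_apply,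
          conv_single]
        rcases List.mem_cons.mp hx with h | h
        · have h1 : s.ofConv (MonoidAlgebra.single x 1) = 1 := by
            rw [hs, WithConv.ofConv_toConv, homAct_dilPhi_single, ← h, mul_inv_cancel,
              PartialModule.act_one]
          rw [h1, mul_one, add_sub_cancel_left]
        · rw [hd' x h, one_mul, add_sub_cancel_right]
  obtain ⟨d, hd, hd'⟩ := key Finset.univ.toList
  have : d = 1 := conv_ext fun g => by rw [hd' g (by simp), convOne_single]
  rwa [← this]

/-- The standard dilation `\overline{A_par(G)}` as an algebra under the convolution product of
`Hom_k(kG, A_par(G))`. -/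
def parDilation (k G : Type*) [Field k] [Group G] [Fintype G] :
    Subalgebra k (WithConv (MonoidAlgebra k G →ₗ[k] Apar k G)) where
  carrier := {f | f.ofConv ∈ stdDilation k G (Apar k G)}
  mul_mem' := stdDilation_mul_mem
  add_mem' := fun hf hf' => (stdDilation k G (Apar k G)).add_mem hf hf'
  algebraMap_mem' r := by
    rw [Algebra.algebraMap_eq_smul_one]
    exact Submodule.smul_mem (stdDilation k G (Apar k G)) r (stdDilation_one_mem k G)

theorem mem_parDilation {k G : Type*} [Field k] [Group G] [Fintype G]
    {f : WithConv (MonoidAlgebra k G →ₗ[k] Apar k G)} :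
    f ∈ parDilation k G ↔ f.ofConv ∈ stdDilation k G (Apar k G) := Iff.rfl

/-- The algebra `\overline{A_par(G)}`. -/
def ParDil (k G : Type*) [Field k] [Group G] [Fintype G] : Type _ := parDilation k G

instance (k G : Type*) [Field k] [Group G] [Fintype G] : Ring (ParDil k G) :=
  inferInstanceAs (Ring (parDilation k G))

instance (k G : Type*) [Field k] [Group G] [Fintype G] : Algebra k (ParDil k G) :=
  inferInstanceAs (Algebra k (parDilation k G))

/-- The action of `g` on the standard dilation of `A_par(G)`. -/
def dilAct {k G : Type*} [Field k] [Group G] [Fintype G] (g : G) (f : ParDil k G) :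
    ParDil k G :=
  ⟨WithConv.toConv (homAct g f.1.ofConv), mem_parDilation.mpr (homAct_mem g (mem_parDilation.mp f.2))⟩

theorem dilAct_single {k G : Type*} [Field k] [Group G] [Fintype G] (g h : G)
    (f : ParDil k G) : (dilAct g f).1.ofConv (MonoidAlgebra.single h 1)
      = f.1.ofConv (MonoidAlgebra.single (h * g) 1) :=
  homAct_single g h f.1.ofConv

theorem ParDil.ext {k G : Type*} [Field k] [Group G] [Fintype G] {f f' : ParDil k G}
    (h : ∀ g : G, f.1.ofConv (MonoidAlgebra.single g 1) = f'.1.ofConv (MonoidAlgebra.single g 1)) :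
    f = f' :=
  Subtype.ext (conv_ext h)

instance (k G : Type*) [Field k] [Group G] [Fintype G] :
    MulSemiringAction G (ParDil k G) where
  smul := dilAct
  one_smul f := ParDil.ext fun x => (dilAct_single 1 x f).trans (by rw [mul_one])
  mul_smul g h f := ParDil.ext fun x => (dilAct_single (g * h) x f).trans (by
    rw [← mul_assoc, ← dilAct_single h, ← dilAct_single g]; rfl)
  smul_zero g := ParDil.ext fun x => dilAct_single g x (0 : ParDil k G)
  smul_add g f f' := ParDil.ext fun x => (dilAct_single g x (f + f')).trans (by
    change _ = (dilAct g f).1.ofConv _ + (dilAct g f').1.ofConv _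
    rw [dilAct_single, dilAct_single]; rfl)
  smul_one g := ParDil.ext fun x => (dilAct_single g x (1 : ParDil k G)).trans
    ((convOne_single (k := k) (A := Apar k G) (x * g)).trans (convOne_single x).symm)
  smul_mul g f f' := ParDil.ext fun x => (dilAct_single g x (f * f')).trans (by
    refine (conv_single f.1 f'.1 (x * g)).trans ?_
    refine Eq.trans ?_ (conv_single (dilAct g f).1 (dilAct g f').1 x).symm
    rw [dilAct_single, dilAct_single])

instance (k G : Type*) [Field k] [Group G] [Fintype G] : SMulCommClass G k (ParDil k G) where
  smul_comm g r f := ParDil.ext fun x => (dilAct_single g x (r • f)).trans (by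
    change r • f.1.ofConv _ = r • (dilAct g f).1.ofConv _
    rw [dilAct_single])

end Dilation

/-! ## The Hom-objects `{M, N}` and `(kG)_glob` -/

section HomObject

/-- The diagonal partial action on `M ⊗ kG`: `g • (m ⊗ x) = (g • m) ⊗ g x`. -/
instance (k G M : Type*) [Field k] [Group G] [AddCommGroup M] [Module k M]
    [PartialModule k G M] : PartialModule k G (M ⊗[k] MonoidAlgebra k G) where
  act g := TensorProduct.map (PartialModule.act g)
    (LinearMap.mulLeft k (MonoidAlgebra.single g 1))
  act_one t := by
    induction t using TensorProduct.induction_on with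
    | zero => simp
    | add x y hx hy => rw [map_add, hx, hy]
    | tmul m x => simp [PartialModule.act_one, ← MonoidAlgebra.one_def]
  act_right g h t := by
    induction t using TensorProduct.induction_on with
    | zero => simp
    | add x y hx hy => simp only [map_add, hx, hy]
    | tmul m x =>
      simp [PartialModule.act_right, ← mul_assoc, MonoidAlgebra.single_mul_single]
  act_left g h t := by
    induction t using TensorProduct.induction_on with
    | zero => simp
    | add x y hx hy => simp only [map_add, hx, hy]
    | tmul m x =>
      simp [PartialModule.act_left, ← mul_assoc, MonoidAlgebra.single_mul_single]

theorem act_tmul {k G M : Type*} [Field k] [Group G] [AddCommGroup M] [Module k M]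
    [PartialModule k G M] (g : G) (m : M) (x : MonoidAlgebra k G) :
    PartialModule.act (k := k) g (m ⊗ₜ[k] x)
      = PartialModule.act (k := k) g m ⊗ₜ[k] (MonoidAlgebra.single g 1 * x) := rfl

/-- The Hom-object `{M, N}`: the morphisms of partial `kG`-modules `M ⊗ kG → N`. -/
def HomObj (k G M N : Type*) [Field k] [Group G] [AddCommGroup M] [Module k M]
    [PartialModule k G M] [AddCommGroup N] [Module k N] [PartialModule k G N] :
    Submodule k (M ⊗[k] MonoidAlgebra k G →ₗ[k] N) where
  carrier := {f | ∀ (g : G) (t : M ⊗[k] MonoidAlgebra k G),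
    f (PartialModule.act (k := k) g t) = PartialModule.act (k := k) g (f t)}
  zero_mem' g t := by simp
  add_mem' hf hf' g t := by simp [hf g t, hf' g t]
  smul_mem' r f hf g t := by simp [hf g t]

/-- The composition `{M, N} ⊗ {N, P} → {M, P}`,
`(φ ∘ χ)(m ⊗ h) = χ (φ (m ⊗ h₁) ⊗ h₂)` in Sweedler notation. -/
def homComp {k G M N P : Type*} [Field k] [Group G] [AddCommGroup M] [Module k M]
    [AddCommGroup N] [Module k N] [AddCommGroup P] [Module k P]
    (φ : M ⊗[k] MonoidAlgebra k G →ₗ[k] N) (χ : N ⊗[k] MonoidAlgebra k G →ₗ[k] P) :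
    M ⊗[k] MonoidAlgebra k G →ₗ[k] P :=
  χ ∘ₗ LinearMap.rTensor (MonoidAlgebra k G) φ ∘ₗ
    (TensorProduct.assoc k M (MonoidAlgebra k G) (MonoidAlgebra k G)).symm.toLinearMap ∘ₗ
    LinearMap.lTensor M (Coalgebra.comul (R := k) (A := MonoidAlgebra k G))

theorem homComp_tmul {k G M N P : Type*} [Field k] [Group G] [AddCommGroup M] [Module k M]
    [AddCommGroup N] [Module k N] [AddCommGroup P] [Module k P]
    (φ : M ⊗[k] MonoidAlgebra k G →ₗ[k] N) (χ : N ⊗[k] MonoidAlgebra k G →ₗ[k] P)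
    (m : M) (g : G) :
    homComp φ χ (m ⊗ₜ MonoidAlgebra.single g 1)
      = χ (φ (m ⊗ₜ MonoidAlgebra.single g 1) ⊗ₜ MonoidAlgebra.single g 1) := by
  simp [homComp]

theorem tensor_ext {k G M V : Type*} [Field k] [AddCommGroup M] [Module k M]
    [AddCommGroup V] [Module k V] {f f' : (M ⊗[k] MonoidAlgebra k G) →ₗ[k] V}
    (h : ∀ (m : M) (g : G), f (m ⊗ₜ MonoidAlgebra.single g 1) = f' (m ⊗ₜ MonoidAlgebra.single g 1)) :
    f = f' :=
  TensorProduct.ext (LinearMap.ext fun m => kG_ext fun g => by simpa using h m g)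

theorem homComp_mem {k G M N P : Type*} [Field k] [Group G] [AddCommGroup M] [Module k M]
    [PartialModule k G M] [AddCommGroup N] [Module k N] [PartialModule k G N]
    [AddCommGroup P] [Module k P] [PartialModule k G P]
    {φ : M ⊗[k] MonoidAlgebra k G →ₗ[k] N} {χ : N ⊗[k] MonoidAlgebra k G →ₗ[k] P}
    (hφ : φ ∈ HomObj k G M N) (hχ : χ ∈ HomObj k G N P) : homComp φ χ ∈ HomObj k G M P := by
  intro g t
  have e : homComp φ χ ∘ₗ PartialModule.act (k := k) g
      = PartialModule.act (k := k) g ∘ₗ homComp φ χ := by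
    refine tensor_ext fun m h => ?_
    simp only [LinearMap.comp_apply, act_tmul, MonoidAlgebra.single_mul_single, mul_one,
      homComp_tmul]
    have h1 := hφ g (m ⊗ₜ MonoidAlgebra.single h 1)
    rw [act_tmul, MonoidAlgebra.single_mul_single, mul_one] at h1
    have h2 := hχ g (φ (m ⊗ₜ MonoidAlgebra.single h 1) ⊗ₜ MonoidAlgebra.single h 1)
    rw [act_tmul, MonoidAlgebra.single_mul_single, mul_one] at h2
    rw [h1, h2]
  exact LinearMap.congr_fun e t

/-- The unit of `{M, M}`: `m ⊗ h ↦ ε(h) m`. -/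
def homUnit (k G M : Type*) [Field k] [Group G] [AddCommGroup M] [Module k M] :
    M ⊗[k] MonoidAlgebra k G →ₗ[k] M :=
  (TensorProduct.rid k M).toLinearMap ∘ₗ
    LinearMap.lTensor M (Coalgebra.counit (R := k) (A := MonoidAlgebra k G))

theorem homUnit_tmul {k G M : Type*} [Field k] [Group G] [AddCommGroup M] [Module k M]
    (m : M) (g : G) : homUnit k G M (m ⊗ₜ MonoidAlgebra.single g 1) = m := by
  simp [homUnit]

theorem homUnit_mem (k G M : Type*) [Field k] [Group G] [AddCommGroup M] [Module k M]
    [PartialModule k G M] : homUnit k G M ∈ HomObj k G M M := by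
  intro g t
  have e : homUnit k G M ∘ₗ PartialModule.act (k := k) g
      = PartialModule.act (k := k) g ∘ₗ homUnit k G M := by
    refine tensor_ext fun m h => ?_
    simp only [LinearMap.comp_apply, act_tmul, MonoidAlgebra.single_mul_single, mul_one,
      homUnit_tmul]
  exact LinearMap.congr_fun e t

/-- The algebra `{M, M}`, with the composition above as product. -/
def EndObj (k G M : Type*) [Field k] [Group G] [AddCommGroup M] [Module k M]
    [PartialModule k G M] : Type _ := HomObj k G M M

theorem EndObj.ext {k G M : Type*} [Field k] [Group G] [AddCommGroup M] [Module k M]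
    [PartialModule k G M] {f f' : EndObj k G M}
    (h : ∀ (m : M) (g : G), f.1 (m ⊗ₜ MonoidAlgebra.single g 1)
      = f'.1 (m ⊗ₜ MonoidAlgebra.single g 1)) : f = f' :=
  Subtype.ext (tensor_ext h)

instance (k G M : Type*) [Field k] [Group G] [AddCommGroup M] [Module k M]
    [PartialModule k G M] : Ring (EndObj k G M) :=
  { (inferInstance : AddCommGroup (HomObj k G M M)) with
    mul := fun φ χ => ⟨homComp φ.1 χ.1, homComp_mem φ.2 χ.2⟩
    one := ⟨homUnit k G M, homUnit_mem k G M⟩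
    left_distrib := fun φ χ χ' => EndObj.ext fun m g => by
      change homComp φ.1 (χ.1 + χ'.1) _ = homComp φ.1 χ.1 _ + homComp φ.1 χ'.1 _
      simp only [homComp_tmul, LinearMap.add_apply]
    right_distrib := fun φ φ' χ => EndObj.ext fun m g => by
      change homComp (φ.1 + φ'.1) χ.1 _ = homComp φ.1 χ.1 _ + homComp φ'.1 χ.1 _
      simp only [homComp_tmul, LinearMap.add_apply, TensorProduct.add_tmul, map_add]
    zero_mul := fun χ => EndObj.ext fun m g => by
      change homComp 0 χ.1 _ = 0
      simp only [homComp_tmul, LinearMap.zero_apply, TensorProduct.zero_tmul, map_zero]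
    mul_zero := fun φ => EndObj.ext fun m g => by
      change homComp φ.1 0 _ = 0
      simp only [homComp_tmul, LinearMap.zero_apply]
    mul_assoc := fun φ χ ψ => EndObj.ext fun m g => by
      change homComp (homComp φ.1 χ.1) ψ.1 _ = homComp φ.1 (homComp χ.1 ψ.1) _
      simp only [homComp_tmul]
    one_mul := fun φ => EndObj.ext fun m g => by
      change homComp (homUnit k G M) φ.1 _ = _
      simp only [homComp_tmul, homUnit_tmul]
    mul_one := fun φ => EndObj.ext fun m g => by
      change homComp φ.1 (homUnit k G M) _ = _
      simp only [homComp_tmul, homUnit_tmul] }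

instance (k G M : Type*) [Field k] [Group G] [AddCommGroup M] [Module k M]
    [PartialModule k G M] : Module k (EndObj k G M) :=
  inferInstanceAs (Module k (HomObj k G M M))

instance (k G M : Type*) [Field k] [Group G] [AddCommGroup M] [Module k M]
    [PartialModule k G M] : Algebra k (EndObj k G M) :=
  Algebra.ofModule
    (fun r φ χ => EndObj.ext fun m g => by
      change homComp (r • φ.1) χ.1 _ = r • homComp φ.1 χ.1 _
      simp only [homComp_tmul, LinearMap.smul_apply, ← TensorProduct.smul_tmul', map_smul])
    (fun r φ χ => EndObj.ext fun m g => by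
      change homComp φ.1 (r • χ.1) _ = r • homComp φ.1 χ.1 _
      simp only [homComp_tmul, LinearMap.smul_apply])

/-- The action of `g` on `{M, M}`: `(g ⇀ f)(m ⊗ x) = f (m ⊗ x g)`. -/
def endAct {k G M : Type*} [Field k] [Group G] [AddCommGroup M] [Module k M]
    [PartialModule k G M] (g : G) (f : EndObj k G M) : EndObj k G M :=
  ⟨f.1 ∘ₗ LinearMap.lTensor M (LinearMap.mulRight k (MonoidAlgebra.single g 1)), by
    intro h t
    rw [LinearMap.comp_apply, LinearMap.comp_apply, ← f.2 h]
    congr 1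
    induction t using TensorProduct.induction_on with
    | zero => simp
    | add x y hx hy => simp only [map_add, hx, hy]
    | tmul m x => simp [act_tmul, mul_assoc]⟩

theorem endAct_tmul {k G M : Type*} [Field k] [Group G] [AddCommGroup M] [Module k M]
    [PartialModule k G M] (g h : G) (f : EndObj k G M) (m : M) :
    (endAct g f).1 (m ⊗ₜ MonoidAlgebra.single h 1)
      = f.1 (m ⊗ₜ MonoidAlgebra.single (h * g) 1) := by
  simp [endAct, MonoidAlgebra.single_mul_single]

instance (k G M : Type*) [Field k] [Group G] [AddCommGroup M] [Module k M]
    [PartialModule k G M] : MulSemiringAction G (EndObj k G M) where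
  smul := endAct
  one_smul f := EndObj.ext fun m x => (endAct_tmul 1 x f m).trans (by rw [mul_one])
  mul_smul g h f := EndObj.ext fun m x => (endAct_tmul (g * h) x f m).trans (by
    rw [← mul_assoc, ← endAct_tmul h, ← endAct_tmul g]; rfl)
  smul_zero g := EndObj.ext fun m x => endAct_tmul g x 0 m
  smul_add g f f' := EndObj.ext fun m x => (endAct_tmul g x (f + f') m).trans (by
    change _ = (endAct g f).1 _ + (endAct g f').1 _
    rw [endAct_tmul, endAct_tmul]; rfl)
  smul_one g := EndObj.ext fun m x => (endAct_tmul g x 1 m).trans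
    ((homUnit_tmul m (x * g)).trans (homUnit_tmul m x).symm)
  smul_mul g f f' := EndObj.ext fun m x => (endAct_tmul g x (f * f') m).trans (by
    change homComp f.1 f'.1 _ = homComp (endAct g f).1 (endAct g f').1 _
    rw [homComp_tmul, homComp_tmul, endAct_tmul, endAct_tmul])

instance (k G M : Type*) [Field k] [Group G] [AddCommGroup M] [Module k M]
    [PartialModule k G M] : SMulCommClass G k (EndObj k G M) where
  smul_comm g r f := EndObj.ext fun m x => (endAct_tmul g x (r • f) m).trans (by
    change r • f.1 _ = r • (endAct g f).1 _
    rw [endAct_tmul])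

/-- `(kG)_glob = {A_par(G), A_par(G)} # kG`. -/
abbrev KGglob (k G : Type*) [Field k] [Group G] : Type _ := Smash k G (EndObj k G (Apar k G))

end HomObject

end PartialGlob

end

noncomputable section

namespace PartialGlob

/-! Everything is compared with the algebra `NESub G → k` of functions on nonempty subsets of G, on
which g acts by (g u)(X) = u(g⁻¹X).

Suppose a module algebra A is equivariantly identified with these functions. Then A # kG has the
basis δ_{gX} # g, and (δ_{gX} # g)(δ_{hY} # h) = δ_{gX} δ_{ghY} # gh, which is δ_{ghY} # gh if X =
hY and 0 otherwise. This is the multiplication table of k_glob G (`kGlobEquivSmash`). The groupoid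
algebra has the same table, because an arrow of Γ_glob(G) is determined by its group element and its
source. It remains to identify three module algebras with the functions.

For B(G), a subset X is sent to the indicator of its supersets, which turns union into product.
Möbius inversion sends Q_X to the point mass at X (`bToFun_bQ`), and the dimensions agree.

The other two algebras rest on A_par(G) ≅ functions on subsets containing 1 (`aparEquivFun`).
Truncated translations represent k_par G on such functions, and ε_g becomes multiplication by the
indicator of g ∈ X. The products of the ε_g and 1 - ε_g are joint eigenvectors of A_par(G) with sum
1, so an element is determined by its eigenvalues (`mul_aparQ`). The partial action becomes
translation of functions extended by zero (`aparEquivFun_act`).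

A function u on all nonempty subsets yields the family u_g = (X ↦ u(g⁻¹X)) in A_par(G), written
`coeff k g u`. It determines u, since every nonempty subset is a translate of one containing 1. In
the dilation u becomes g ↦ u_g, and point masses correspond to generators. In {A_par, A_par} it
becomes a ⊗ g ↦ a u_g. Conversely, every morphism f is A_par(G)-linear in its first argument, and
equivariance makes the functions f(1 ⊗ g) glue to a single u (`aparEquivFun_map_eq`). -/

theorem map_bilinExt {k ι R : Type*} [Field k] [Ring R] [Algebra k R]
    (m : ι → ι → (ι →₀ k)) (f : (ι →₀ k) →ₗ[k] R)
    (h : ∀ i j, f (m i j) = f (Finsupp.single i 1) * f (Finsupp.single j 1)) (x y : ι →₀ k) :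
    f (bilinExt m x y) = f x * f y := by
  have e : (bilinExt m).compr₂ f = (LinearMap.mul k R).compl₁₂ f f := by
    refine Finsupp.lhom_ext' fun i => LinearMap.ext_ring ?_
    refine Finsupp.lhom_ext' fun j => LinearMap.ext_ring ?_
    simpa [bilinExt_single] using h i j
  exact LinearMap.congr_fun₂ e x y

/-! ### Arrows of Γ_glob(G) as pairs -/

/-- Pairs `(g, A)` are the arrows of `Γ_glob(G)`. -/
def pairEquivMor (G : Type*) [Group G] [DecidableEq G] :
    G × NESub G ≃ Mor (GammaGlob G) where
  toFun p := ⟨⟨p.2⟩, ⟨p.1 • p.2⟩, ⟨p.1, rfl⟩⟩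
  invFun γ := (γ.hom.1, γ.src.carrier)
  left_inv _ := rfl
  right_inv := by
    rintro ⟨⟨A⟩, ⟨B⟩, ⟨g, rfl : g • A = B⟩⟩
    rfl

theorem pairEquivMor_comp {G : Type*} [Group G] [DecidableEq G] (g h : G) (B : NESub G)
    (H : (pairEquivMor G (h, B)).tgt = (pairEquivMor G (g, h • B)).src) :
    (pairEquivMor G (g, h • B)).comp (pairEquivMor G (h, B)) H = pairEquivMor G (g * h, B) := by
  apply (pairEquivMor G).symm.injective
  refine Prod.ext ?_ rfl
  -- The middle factor is the group element of the `eqToHom` inserted by `Mor.comp`.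
  change g * 1 * h = g * h
  rw [mul_one]

/-- `k_glob G` is the groupoid algebra of `Γ_glob(G)`. -/
def kGlobEquivGroupoid (k G : Type*) [Field k] [Group G] [Fintype G] [DecidableEq G] :
    KGlob k G ≃ₐ[k] GroupoidAlgebra k (GammaGlob G) :=
  AlgEquiv.ofLinearEquiv
    (Finsupp.domLCongr (pairEquivMor G) : (G × NESub G →₀ k) ≃ₗ[k] (Mor (GammaGlob G) →₀ k))
    (by
      change Finsupp.domLCongr (pairEquivMor G) (∑ A : NESub G, Finsupp.single (1, A) (1 : k))
        = ∑ x : GammaGlob G, Finsupp.single ⟨x, x, CategoryTheory.CategoryStruct.id x⟩ (1 : k)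
      rw [map_sum]
      refine Fintype.sum_equiv ⟨GammaGlob.mk, GammaGlob.carrier, fun _ => rfl, fun _ => rfl⟩ _ _
        fun A => ?_
      rw [Finsupp.domLCongr_single]
      congr 1
      apply (pairEquivMor G).symm.injective
      rfl)
    (map_bilinExt (R := GroupoidAlgebra k (GammaGlob G)) (kGlobProd k)
      (Finsupp.domLCongr (pairEquivMor G)).toLinearMap (by
        rintro ⟨g, A⟩ ⟨h, B⟩
        change Finsupp.domLCongr (pairEquivMor G) (kGlobProd k (g, A) (h, B))
          = bilinExt (Mor.prod k) (Finsupp.domLCongr (pairEquivMor G) (Finsupp.single (g, A) 1))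
              (Finsupp.domLCongr (pairEquivMor G) (Finsupp.single (h, B) 1))
        rw [Finsupp.domLCongr_single, Finsupp.domLCongr_single, bilinExt_single]
        by_cases H : A = h • B
        · subst H
          have H' : (pairEquivMor G (h, B)).tgt = (pairEquivMor G (g, h • B)).src := rfl
          rw [kGlobProd, if_pos rfl, Mor.prod, dif_pos H', pairEquivMor_comp,
            Finsupp.domLCongr_single]
        · have H' : ¬ (pairEquivMor G (h, B)).tgt = (pairEquivMor G (g, A)).src :=
            fun e => H (congrArg GammaGlob.carrier e).symm
          rw [kGlobProd, if_neg H, Mor.prod, dif_neg H', map_zero]))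

/-! ### Smash products of function algebras with kG -/

section SmashOfFunctions

variable {k G A : Type*} [Field k] [Group G] [Fintype G] [DecidableEq G] [Ring A] [Algebra k A]

/-- The basis of `A # kG` indexed by pairs `(g, X)` when `A` is the algebra of functions
on nonempty subsets. -/
def smashBasis (e : A ≃ₐ[k] (NESub G → k)) :
    Module.Basis (G × NESub G) k (A ⊗[k] MonoidAlgebra k G) :=
  (((Pi.basisFun k (NESub G)).map e.symm.toLinearEquiv).tensorProduct
    (MonoidAlgebra.basis G k)).reindex
    -- A pair is labelled by the source of the arrow, while the point mass to the left of # sits at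
    -- the target; hence the shift by g⁻¹.
    { toFun := fun p => (p.2, p.2⁻¹ • p.1)
      invFun := fun p => (p.1 • p.2, p.1)
      left_inv := fun p => by simp
      right_inv := fun p => by simp }

theorem smashBasis_apply (e : A ≃ₐ[k] (NESub G → k)) (g : G) (X : NESub G) :
    smashBasis e (g, X) = e.symm (Pi.single (g • X) 1) ⊗ₜ MonoidAlgebra.single g 1 := by
  simp [smashBasis, Module.Basis.tensorProduct_apply]

/-- A `G`-equivariant identification of `A` with the functions on nonempty subsets identifies
`k_glob G` with `A # kG`. -/
def kGlobEquivSmash [MulSemiringAction G A] [SMulCommClass G k A] (e : A ≃ₐ[k] (NESub G → k))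
    (he : ∀ (g : G) (a : A) (X : NESub G), e (g • a) X = e a (g⁻¹ • X)) :
    KGlob k G ≃ₐ[k] Smash k G A :=
  AlgEquiv.ofLinearEquiv
    ((smashBasis e).repr.symm : (G × NESub G →₀ k) ≃ₗ[k] (A ⊗[k] MonoidAlgebra k G))
    (by
      change (smashBasis e).repr.symm (∑ X : NESub G, Finsupp.single (1, X) (1 : k))
        = (1 : A) ⊗ₜ[k] MonoidAlgebra.single (1 : G) (1 : k)
      simp only [map_sum, Module.Basis.repr_symm_single_one, smashBasis_apply, one_smul]
      rw [← TensorProduct.sum_tmul, ← map_sum]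
      congr 1
      rw [← map_one e.symm]
      congr 1
      ext X
      simp [Finset.sum_apply, Pi.single_apply])
    (map_bilinExt (R := Smash k G A) (kGlobProd k) (smashBasis e).repr.symm.toLinearMap (by
      rintro ⟨g, X⟩ ⟨h, Y⟩
      change (smashBasis e).repr.symm (kGlobProd k (g, X) (h, Y))
        = Smash.mulMap k G A ((smashBasis e).repr.symm (Finsupp.single (g, X) 1))
            ((smashBasis e).repr.symm (Finsupp.single (h, Y) 1))
      rw [Module.Basis.repr_symm_single_one, Module.Basis.repr_symm_single_one, smashBasis_apply,
        smashBasis_apply, Smash.mulMap_tmul]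
      have hs : g • e.symm (Pi.single (h • Y) 1) = e.symm (Pi.single (g • h • Y) 1) := by
        apply e.injective
        ext Z
        rw [he, e.apply_symm_apply, e.apply_symm_apply]
        simp [Pi.single_apply, inv_smul_eq_iff]
      -- The product now carries the point masses at gX and ghY, which coincide exactly when X = hY
      -- and are orthogonal otherwise.
      rw [hs, ← map_mul, kGlobProd]
      by_cases H : X = h • Y
      · subst H
        rw [if_pos rfl, Module.Basis.repr_symm_single_one, smashBasis_apply, mul_smul,
          ← Pi.single_mul, one_mul]
      · have h0 : (Pi.single (g • X) 1 * Pi.single (g • h • Y) 1 : NESub G → k) = 0 := by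
          ext Z
          rcases eq_or_ne Z (g • X) with rfl | hZ
          · have H' : ¬ g • X = g • h • Y := by simpa using H
            simp [H']
          · simp [hZ]
        rw [if_neg H, map_zero, h0, map_zero, TensorProduct.zero_tmul]))

end SmashOfFunctions

/-! ### B(G) as functions, by Möbius inversion -/

section SemigroupAlgebra

variable (k G : Type*) [Field k] [Fintype G] [DecidableEq G]

/-- The linear map `B(G) → k^{P'(G)}` that sends `X` to the indicator of the supersets of `X`. -/
def bToFun : BAlg k G →ₗ[k] (NESub G → k) :=
  (MonoidAlgebra.basis (NESub G) k).constr k (fun X Y => if X.1 ⊆ Y.1 then 1 else 0)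

theorem bToFun_of (X : NESub G) : bToFun k G (bOf k X) = fun Y => if X.1 ⊆ Y.1 then 1 else 0 := by
  change (MonoidAlgebra.basis (NESub G) k).constr k _ (MonoidAlgebra.single X 1) = _
  rw [← MonoidAlgebra.basis_apply]
  exact Module.Basis.constr_basis _ _ _ _

/-- A set contains X ∪ Y exactly when it contains both X and Y, so indicators of supersets multiply.
-/
theorem bToFun_mul (x y : BAlg k G) : bToFun k G (x * y) = bToFun k G x * bToFun k G y := by
  have h : (LinearMap.mul k (BAlg k G)).compr₂ (bToFun k G)
      = (LinearMap.mul k (NESub G → k)).compl₁₂ (bToFun k G) (bToFun k G) := by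
    refine bLhom_ext fun X => bLhom_ext fun Y => ?_
    ext Z
    simp [bOf_mul, bToFun_of, NESub.coe_mul, Finset.union_subset_iff, ← ite_and, and_comm]
  exact LinearMap.congr_fun₂ h x y

/-- Writing Y = X ∪ S with S ⊆ Z \ X reduces this to the alternating sum over the subsets of Z \ X,
which vanishes unless Z \ X is empty. -/
theorem sum_neg_one_pow_between {G : Type*} [DecidableEq G] {X Z : Finset G} (h : X ⊆ Z) :
    ∑ Y ∈ Finset.Icc X Z, (-1 : k) ^ (Y.card - X.card) = if X = Z then 1 else 0 := by
  rw [Finset.Icc_eq_image_powerset h, Finset.sum_image]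
  · have h1 : ∀ S ∈ (Z \ X).powerset, (-1 : k) ^ ((X ∪ S).card - X.card) = (-1) ^ S.card := by
      intro S hS
      rw [Finset.card_union_of_disjoint, Nat.add_sub_cancel_left]
      exact (Finset.disjoint_of_subset_left (Finset.mem_powerset.mp hS)
        Finset.sdiff_disjoint).symm
    rw [Finset.sum_congr rfl h1]
    have h2 := congrArg (Int.cast (R := k)) (Finset.sum_powerset_neg_one_pow_card (x := Z \ X))
    push_cast at h2
    rw [h2]
    congr 1
    rw [Finset.sdiff_eq_empty_iff_subset]
    exact propext ⟨fun h' => h.antisymm h', fun h' => h' ▸ subset_rfl⟩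
  · intro S hS T hT hST
    -- S is recovered from X ∪ S by removing X, so the parametrization of the interval is injective.
    have key : ∀ S ∈ (Z \ X).powerset, (X ∪ S) \ X = S := fun S hS => by
      rw [Finset.union_sdiff_left]
      exact Finset.sdiff_eq_self_of_disjoint
        (Finset.disjoint_of_subset_left (Finset.mem_powerset.mp hS) Finset.sdiff_disjoint)
    rw [← key S hS, ← key T hT]
    exact congrArg (· \ X) hST

/-- The value at Z is the alternating sum over the interval from X to Z. No nonemptiness condition
is lost there, since every member contains X. -/
theorem bToFun_bQ (X : NESub G) : bToFun k G (bQ k X) = Pi.single X 1 := by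
  ext Z
  rw [bQ, map_sum, Finset.sum_apply]
  simp only [map_smul, bToFun_of, Pi.smul_apply, smul_eq_mul, mul_ite, mul_one, mul_zero]
  rw [← Finset.sum_filter, Finset.filter_filter]
  have hs : ∑ Y : NESub G with X.1 ⊆ Y.1 ∧ Y.1 ⊆ Z.1, (-1 : k) ^ (Y.1.card - X.1.card)
      = ∑ Y ∈ Finset.Icc X.1 Z.1, (-1 : k) ^ (Y.card - X.1.card) := by
    refine Finset.sum_bij (fun Y _ => Y.1) ?_ ?_ ?_ ?_
    · intro Y hY; simpa using hY
    · intro Y _ Y' _ h; exact Subtype.ext h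
    · intro Y hY
      have hY' := Finset.mem_Icc.mp hY
      exact ⟨⟨Y, X.2.mono hY'.1⟩, Finset.mem_filter.mpr ⟨Finset.mem_univ _, hY'⟩, rfl⟩
    · intro Y _; rfl
  rw [hs, Pi.single_apply]
  by_cases h : X.1 ⊆ Z.1
  · rw [sum_neg_one_pow_between k h]
    simp [Subtype.ext_iff, eq_comm]
  · rw [Finset.Icc_eq_empty h, Finset.sum_empty, if_neg]
    rintro rfl
    exact h subset_rfl

/-- All point masses are attained, and both sides have dimension the number of nonempty subsets. -/
theorem bToFun_bijective : Function.Bijective (bToFun k G) := by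
  have hsurj : Function.Surjective (bToFun k G) := by
    intro u
    refine ⟨∑ X, u X • bQ k X, ?_⟩
    simp only [map_sum, map_smul, bToFun_bQ]
    ext Z
    simp [Finset.sum_apply, Pi.single_apply]
  let b : Module.Basis (NESub G) k (BAlg k G) := MonoidAlgebra.basis (NESub G) k
  have : FiniteDimensional k (BAlg k G) := b.finiteDimensional_of_finite
  refine ⟨?_, hsurj⟩
  rw [LinearMap.injective_iff_surjective_of_finrank_eq_finrank]
  · exact hsurj
  · rw [Module.finrank_eq_card_basis b, Module.finrank_fintype_fun_eq_card]

/-- `B(G)` is the algebra of functions on nonempty subsets. -/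
def bEquivFun : BAlg k G ≃ₐ[k] (NESub G → k) :=
  AlgEquiv.ofLinearEquiv (LinearEquiv.ofBijective (bToFun k G) (bToFun_bijective k G))
    (by
      change bToFun k G 1 = 1
      -- The alternating sum defining the unit is not evaluated: a multiplicative surjection
      -- preserves units, as seen by multiplying 1 with a preimage of 1.
      obtain ⟨x, hx⟩ := (bToFun_bijective k G).2 1
      have h := bToFun_mul k G 1 x
      rwa [one_mul, hx, mul_one, eq_comm] at h)
    (bToFun_mul k G)

/-- On a basis element Y this is the equivalence of gY ⊆ X and Y ⊆ g⁻¹X. -/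
theorem bEquivFun_smul {k G : Type*} [Field k] [Group G] [Fintype G] [DecidableEq G] (g : G)
    (x : BAlg k G) (X : NESub G) : bEquivFun k G (g • x) X = bEquivFun k G x (g⁻¹ • X) := by
  have h : LinearMap.proj X ∘ₗ bToFun k G ∘ₗ bAct k g
      = LinearMap.proj (g⁻¹ • X) ∘ₗ bToFun k G := by
    refine bLhom_ext fun Y => ?_
    simp [bAct_of, bToFun_of, NESub.coe_smul, Finset.subset_smul_finset_iff]
  exact LinearMap.congr_fun h x

end SemigroupAlgebra

/-! ### A_par(G) as functions on the subsets containing 1 -/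

section PartialRepresentation

/-- The subsets of `G` that contain the identity. -/
abbrev UnitSub (G : Type*) [Group G] : Type _ := {X : NESub G // (1 : G) ∈ X.1}

variable {k G : Type*} [Field k] [Group G] [DecidableEq G]

theorem one_mem_smul_iff (g : G) (Z : NESub G) : (1 : G) ∈ (g • Z).1 ↔ g⁻¹ ∈ Z.1 := by
  rw [NESub.coe_smul, ← Finset.inv_smul_mem_iff, smul_eq_mul, mul_one]

/-- Extension by zero of a function on the subsets containing the identity. -/
def extZero : (UnitSub G → k) →ₗ[k] (NESub G → k) where
  toFun f Z := if h : (1 : G) ∈ Z.1 then f ⟨Z, h⟩ else 0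
  map_add' f f' := by ext Z; by_cases h : (1 : G) ∈ Z.1 <;> simp [h]
  map_smul' r f := by ext Z; by_cases h : (1 : G) ∈ Z.1 <;> simp [h]

theorem extZero_pos (f : UnitSub G → k) {Z : NESub G} (h : (1 : G) ∈ Z.1) :
    extZero f Z = f ⟨Z, h⟩ := dif_pos h

theorem extZero_neg (f : UnitSub G → k) {Z : NESub G} (h : ¬ (1 : G) ∈ Z.1) :
    extZero f Z = 0 := dif_neg h

theorem extZero_mul (f f' : UnitSub G → k) : extZero (f * f') = extZero f * extZero f' := by
  ext Z
  by_cases h : (1 : G) ∈ Z.1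
  · simp [extZero_pos _ h]
  · simp [extZero_neg _ h]

/-- The partial action of `G` on functions on the subsets containing the identity. -/
def parOp (k : Type*) [Field k] (g : G) : Module.End k (UnitSub G → k) where
  toFun f X := extZero f (g⁻¹ • X.1)
  map_add' f f' := by ext X; simp
  map_smul' r f := by ext X; simp

theorem parOp_apply (g : G) (f : UnitSub G → k) (X : UnitSub G) :
    parOp k g f X = extZero f (g⁻¹ • X.1) := rfl

/-- Composing partial translations truncates at every intermediate subset. This formula records one
such truncation. -/
theorem extZero_parOp (g : G) (f : UnitSub G → k) (Z : NESub G) :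
    extZero (parOp k g f) Z = if (1 : G) ∈ Z.1 then extZero f (g⁻¹ • Z) else 0 := by
  by_cases h : (1 : G) ∈ Z.1
  · rw [extZero_pos _ h, if_pos h, parOp_apply]
  · rw [extZero_neg _ h, if_neg h]

theorem parOp_one : parOp k (1 : G) = 1 := by
  refine LinearMap.ext fun f => funext fun X => ?_
  rw [parOp_apply, inv_one, one_smul, extZero_pos _ X.2]
  rfl

/-- The left side has the additional condition 1 ∈ g⁻¹X. It costs nothing, because the final value
is the extension by zero of f at g⁻¹X. -/
theorem parOp_right (g h : G) :
    parOp k g * parOp k h * parOp k h⁻¹ = parOp k (g * h) * parOp k h⁻¹ := by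
  refine LinearMap.ext fun f => funext fun X => ?_
  simp only [Module.End.mul_apply, parOp_apply, extZero_parOp, inv_inv, mul_inv_rev, mul_smul,
    smul_inv_smul]
  by_cases H : (1 : G) ∈ (g⁻¹ • X.1).1
  · rw [if_pos H]
  · rw [if_neg H, extZero_neg _ H, ite_self]

/-- Here the additional condition on the left is 1 ∈ X, which holds by the choice of X. -/
theorem parOp_left (g h : G) :
    parOp k g⁻¹ * parOp k g * parOp k h = parOp k g⁻¹ * parOp k (g * h) := by
  refine LinearMap.ext fun f => funext fun X => ?_
  simp only [Module.End.mul_apply, parOp_apply, extZero_parOp, inv_inv, mul_inv_rev, mul_smul,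
    inv_smul_smul, if_pos X.2]

/-- The representation of `k_par G` on functions on the subsets containing the identity. -/
def parRep (k G : Type*) [Field k] [Group G] [DecidableEq G] :
    KPar k G →ₐ[k] Module.End k (UnitSub G → k) :=
  RingQuot.liftAlgHom k ⟨FreeAlgebra.lift k (parOp k), fun x y h => by
    induction h with
    | one => simp [parOp_one]
    | right g h => simp [parOp_right]
    | left g h => simp [parOp_left]⟩

theorem parRep_br (g : G) : parRep k G (br k g) = parOp k g := by
  refine (RingQuot.liftAlgHom_mkAlgHom_apply k _ _ _).trans ?_
  simp

/-- Translating out and back restores f but keeps only those X whose translate g⁻¹X contains 1, that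
is, those with g ∈ X. -/
theorem parRep_eps (g : G) (f : UnitSub G → k) :
    parRep k G (eps k g) f = (fun X : UnitSub G => if g ∈ X.1.1 then 1 else 0) * f := by
  ext X
  rw [eps, map_mul, Module.End.mul_apply, parRep_br, parRep_br, parOp_apply, extZero_parOp,
    inv_inv, smul_inv_smul, extZero_pos _ X.2]
  simp [one_mem_smul_iff]

/-- The generators act by multiplication operators, and these form an algebra. Such an operator is
determined by its value at the constant 1, which provides the map to functions. -/
theorem parRep_Apar {a : KPar k G} (ha : a ∈ Apar k G) (f : UnitSub G → k) :
    parRep k G a f = parRep k G a 1 * f := by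
  induction ha using Algebra.adjoin_induction generalizing f with
  | mem x hx =>
    obtain ⟨g, rfl⟩ := hx
    rw [parRep_eps, parRep_eps, mul_one]
  | algebraMap r => simp [Algebra.algebraMap_eq_smul_one]
  | add x y _ _ hx hy => rw [map_add, LinearMap.add_apply, LinearMap.add_apply, hx, hy, add_mul]
  | mul x y _ _ hx hy =>
    rw [map_mul, Module.End.mul_apply, Module.End.mul_apply, hx (parRep k G y f),
      hx (parRep k G y 1), hy, mul_assoc]

/-- `A_par(G)` acts on functions by multiplication operators. -/
def aparToFun (k G : Type*) [Field k] [Group G] [DecidableEq G] :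
    Apar k G →ₐ[k] (UnitSub G → k) :=
  AlgHom.ofLinearMap
    { toFun := fun a => parRep k G a.1 1
      map_add' := fun a b => by simp
      map_smul' := fun r a => by simp }
    (by simp)
    (fun a b => by
      change parRep k G (a.1 * b.1) 1 = _
      rw [map_mul, Module.End.mul_apply, parRep_Apar a.2]
      rfl)

/-- The generator `ε_g` as an element of `A_par(G)`. -/
def aparEps (k : Type*) {G : Type*} [Field k] [Group G] (g : G) : Apar k G := ⟨eps k g, eps_mem k g⟩

theorem aparToFun_eps (g : G) (X : UnitSub G) :
    aparToFun k G (aparEps k g) X = if g ∈ X.1.1 then 1 else 0 := by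
  change parRep k G (eps k g) 1 X = _
  rw [parRep_eps, mul_one]

/-- Conjugating a multiplication operator by partial translations translates its symbol; the
truncation is absorbed by the extension by zero. -/
theorem aparToFun_act (g : G) (a : Apar k G) (X : UnitSub G) :
    aparToFun k G (PartialModule.act (k := k) g a) X = extZero (aparToFun k G a) (g⁻¹ • X.1) := by
  change parRep k G (br k g * a.1 * br k g⁻¹) 1 X = _
  rw [map_mul, map_mul, Module.End.mul_apply, Module.End.mul_apply, parRep_br, parRep_br,
    parOp_apply, parRep_Apar a.2, extZero_mul, Pi.mul_apply, extZero_parOp, inv_inv, smul_inv_smul,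
    extZero_pos _ X.2, Pi.one_apply]
  change extZero (aparToFun k G a) _ * _ = _
  by_cases h : (1 : G) ∈ (g⁻¹ • X.1).1
  · rw [if_pos h, mul_one]
  · rw [if_neg h, extZero_neg _ h, mul_zero]

theorem apar_induction {k G : Type*} [Field k] [Group G] {p : Apar k G → Prop}
    (heps : ∀ g, p (aparEps k g)) (hsmul : ∀ (r : k), p (algebraMap k _ r))
    (hadd : ∀ a b, p a → p b → p (a + b)) (hmul : ∀ a b, p a → p b → p (a * b)) (a : Apar k G) :
    p a := by
  obtain ⟨a, ha⟩ := a
  induction ha using Algebra.adjoin_induction with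
  | mem x hx => obtain ⟨g, rfl⟩ := hx; exact heps g
  | algebraMap r => exact hsmul r
  | add x y hx' hy' hx hy => exact hadd _ _ hx hy
  | mul x y hx' hy' hx hy => exact hmul _ _ hx hy

theorem apar_mul_comm {k G : Type*} [Field k] [Group G] (a b : Apar k G) : a * b = b * a := by
  induction a using apar_induction with
  | heps g => exact Subtype.ext (eps_comm_Apar g b.2)
  | hsmul r => exact Algebra.commutes r b
  | hadd a a' h h' => rw [add_mul, mul_add, h, h']
  | hmul a a' h h' => rw [mul_assoc, h', ← mul_assoc, h, mul_assoc]

/-- `A_par(G)` is commutative. -/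
abbrev aparCommRing (k G : Type*) [Field k] [Group G] : CommRing (Apar k G) :=
  { (inferInstance : Ring (Apar k G)) with mul_comm := apar_mul_comm }

attribute [local instance] aparCommRing

theorem aparEps_one (k G : Type*) [Field k] [Group G] : aparEps k (1 : G) = 1 :=
  Subtype.ext (by simp [aparEps, eps, br_one])

theorem aparEps_mul_self {k G : Type*} [Field k] [Group G] (g : G) :
    aparEps k g * aparEps k g = aparEps k g :=
  Subtype.ext (by
    change eps k g * eps k g = eps k g
    rw [eps, ← mul_assoc, br_inv_br])

variable [Fintype G]

/-- The idempotent of `A_par(G)` attached to a subset. -/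
def aparQ (k : Type*) [Field k] (S : Finset G) : Apar k G :=
  (∏ g ∈ S, aparEps k g) * ∏ g ∈ Finset.univ \ S, (1 - aparEps k g)

/-- Expand the product over g of ε_g + (1 - ε_g) = 1. -/
theorem sum_aparQ (k G : Type*) [Field k] [Group G] [DecidableEq G] [Fintype G] :
    ∑ S : Finset G, aparQ k S = 1 := by
  have h := Finset.prod_add (fun g : G => aparEps k g) (fun g => 1 - aparEps k g) Finset.univ
  simp only [add_sub_cancel, Finset.prod_const_one, Finset.powerset_univ] at h
  exact h.symm

/-- The idempotent ε_g is absorbed by a factor ε_g and killed by a factor 1 - ε_g. -/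
theorem aparEps_mul_aparQ (g : G) (S : Finset G) :
    aparEps k g * aparQ k S = (if g ∈ S then 1 else 0 : k) • aparQ k S := by
  rw [aparQ]
  by_cases h : g ∈ S
  · rw [if_pos h, one_smul, ← mul_assoc, ← Finset.mul_prod_erase _ _ h, ← mul_assoc,
      aparEps_mul_self]
  · have h' : g ∈ Finset.univ \ S := by simpa using h
    rw [if_neg h, zero_smul, ← Finset.mul_prod_erase _ _ h', mul_left_comm, ← mul_assoc (aparEps k g),
      mul_sub, aparEps_mul_self, mul_one, sub_self, zero_mul, mul_zero]

/-- Since ε_1 = 1, multiplication by ε_1 both fixes and annihilates the idempotent. This is why only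
subsets containing 1 survive. -/
theorem aparQ_eq_zero {S : Finset G} (h : (1 : G) ∉ S) : aparQ k S = 0 := by
  have e := aparEps_mul_aparQ (k := k) 1 S
  rwa [if_neg h, zero_smul, aparEps_one, one_mul] at e

/-- The idempotent is a joint eigenvector of A_par(G), and the eigenvalue of a is the value of its
function at X. It suffices to compare on the ε_g, because eigenvalues are additive and
multiplicative in a. -/
theorem mul_aparQ (a : Apar k G) (X : UnitSub G) :
    a * aparQ k X.1.1 = aparToFun k G a X • aparQ k X.1.1 := by
  induction a using apar_induction with
  | heps g => rw [aparToFun_eps, aparEps_mul_aparQ]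
  | hsmul r => rw [← Algebra.smul_def, AlgHom.commutes]; rfl
  | hadd a b ha hb => rw [add_mul, ha, hb, map_add, Pi.add_apply, add_smul]
  | hmul a b ha hb =>
    rw [mul_assoc, hb, mul_smul_comm, ha, map_mul, Pi.mul_apply, smul_smul, mul_comm]

theorem aparToFun_aparQ (X : UnitSub G) : aparToFun k G (aparQ k X.1.1) = Pi.single X 1 := by
  ext Y
  have hY : aparToFun k G (aparQ k X.1.1) Y
      = (∏ g ∈ X.1.1, if g ∈ Y.1.1 then (1 : k) else 0)
        * ∏ g ∈ Finset.univ \ X.1.1, (1 - if g ∈ Y.1.1 then (1 : k) else 0) := by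
    simp only [aparQ, map_mul, map_prod, map_sub, map_one, Pi.mul_apply, Finset.prod_apply,
      Pi.sub_apply, Pi.one_apply, aparToFun_eps]
  rw [hY]
  rcases eq_or_ne Y X with rfl | hne
  · rw [Pi.single_eq_same, Finset.prod_congr rfl (fun g hg => if_pos hg), Finset.prod_const_one,
      one_mul]
    refine Finset.prod_eq_one fun g hg => ?_
    rw [if_neg (Finset.mem_sdiff.mp hg).2, sub_zero]
  · rw [Pi.single_eq_of_ne hne]
    by_cases hs : X.1.1 ⊆ Y.1.1
    -- If Y strictly contains X, an element g of Y \ X makes the factor belonging to 1 - ε_g vanish.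
    · obtain ⟨g, hgY, hgX⟩ := Finset.not_subset.mp
        (fun h => hne (Subtype.ext (Subtype.ext (h.antisymm hs))))
      rw [Finset.prod_eq_zero (i := g) (s := Finset.univ \ X.1.1) (by simpa using hgX)
        (by rw [if_pos hgY, sub_self]), mul_zero]
    · obtain ⟨g, hgX, hgY⟩ := Finset.not_subset.mp hs
      rw [Finset.prod_eq_zero hgX (if_neg hgY), zero_mul]

/-- Multiplying a by the decomposition of 1 gives a = ∑ a(X) q_X over the subsets X containing 1,
with q_X the eigenvector of `mul_aparQ`. Hence a vanishes with its function. Surjectivity holds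
because q_X maps to the point mass at X. -/
theorem aparToFun_bijective (k G : Type*) [Field k] [Group G] [DecidableEq G] [Fintype G] :
    Function.Bijective (aparToFun k G) := by
  constructor
  · rw [injective_iff_map_eq_zero]
    intro a ha
    rw [← mul_one a, ← sum_aparQ, Finset.mul_sum]
    refine Finset.sum_eq_zero fun S _ => ?_
    by_cases h : (1 : G) ∈ S
    · rw [mul_aparQ a ⟨⟨S, 1, h⟩, h⟩, ha, Pi.zero_apply, zero_smul]
    · rw [aparQ_eq_zero h, mul_zero]
  · intro u
    refine ⟨∑ X, u X • aparQ k X.1.1, ?_⟩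
    simp only [map_sum, map_smul, aparToFun_aparQ]
    ext Z
    simp [Finset.sum_apply, Pi.single_apply]

/-- `A_par(G)` is the algebra of functions on the subsets containing the identity. -/
def aparEquivFun (k G : Type*) [Field k] [Group G] [DecidableEq G] [Fintype G] :
    Apar k G ≃ₐ[k] (UnitSub G → k) :=
  AlgEquiv.ofBijective (aparToFun k G) (aparToFun_bijective k G)

theorem aparEquivFun_act (g : G) (a : Apar k G) (X : UnitSub G) :
    aparEquivFun k G (PartialModule.act (k := k) g a) X
      = extZero (aparEquivFun k G a) (g⁻¹ • X.1) :=
  aparToFun_act g a X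

end PartialRepresentation

/-! ### Functions on nonempty subsets as families in A_par(G) -/

section Coefficients

variable {k G : Type*} [Field k] [Group G] [Fintype G] [DecidableEq G]

/-- The element of `A_par(G)` that corresponds to `X ↦ u (g⁻¹ X)`. -/
def coeff (k : Type*) [Field k] (g : G) : (NESub G → k) →ₐ[k] Apar k G :=
  (aparEquivFun k G).symm.toAlgHom.comp
    (AlgHom.pi fun X : UnitSub G => Pi.evalAlgHom k _ (g⁻¹ • X.1))

theorem aparEquivFun_coeff (g : G) (u : NESub G → k) (X : UnitSub G) :
    aparEquivFun k G (coeff k g u) X = u (g⁻¹ • X.1) := by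
  simp [coeff]

theorem apar_ext {a b : Apar k G} (h : ∀ X, aparEquivFun k G a X = aparEquivFun k G b X) :
    a = b :=
  (aparEquivFun k G).injective (funext h)

/-- Left translation of subsets becomes right translation of the index g, which is how G acts on
both the dilation and {A_par, A_par}. -/
theorem coeff_translate (g h : G) (u : NESub G → k) :
    coeff k g (fun X => u (h⁻¹ • X)) = coeff k (g * h) u :=
  apar_ext fun X => by
    rw [aparEquivFun_coeff, aparEquivFun_coeff, mul_inv_rev, mul_smul]

/-- For z ∈ Z the set z⁻¹Z contains 1, and u(Z) is the value there of the member of the family with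
index z⁻¹. -/
theorem coeff_injective {u v : NESub G → k} (h : ∀ g, coeff k g u = coeff k g v) : u = v := by
  ext Z
  obtain ⟨z, hz⟩ := Z.2
  have hX : (1 : G) ∈ (z⁻¹ • Z).1 := by rwa [one_mem_smul_iff, inv_inv]
  have e := congrArg (fun a => aparEquivFun k G a ⟨z⁻¹ • Z, hX⟩) (h z⁻¹)
  simpa only [aparEquivFun_coeff, inv_inv, smul_inv_smul] using e

/-- Where 1 ∈ h⁻¹X both sides take the same value, and elsewhere both vanish, through the truncation
in h • a. This is the equivariance of a ⊗ g ↦ a u_g. -/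
theorem act_mul_coeff (h g : G) (a : Apar k G) (u : NESub G → k) :
    (PartialModule.act (k := k) h a : Apar k G) * coeff k (h * g) u
      = PartialModule.act (k := k) h (a * coeff k g u) :=
  apar_ext fun X => by
    rw [map_mul, Pi.mul_apply, aparEquivFun_act, aparEquivFun_act, aparEquivFun_coeff, map_mul,
      extZero_mul, Pi.mul_apply]
    by_cases H : (1 : G) ∈ (h⁻¹ • X.1).1
    · rw [extZero_pos (aparEquivFun k G (coeff k g u)) H, aparEquivFun_coeff, mul_inv_rev, mul_smul]
    · rw [extZero_neg _ H, zero_mul, zero_mul]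

/-- The linear map `kG → A_par(G)` with values `coeff k g u`. -/
def coeffLin (k G : Type*) [Field k] [Group G] [Fintype G] [DecidableEq G] :
    (NESub G → k) →ₗ[k] (MonoidAlgebra k G →ₗ[k] Apar k G) :=
  ((MonoidAlgebra.basis G k).constr k).toLinearMap ∘ₗ LinearMap.pi fun g => (coeff k g).toLinearMap

theorem coeffLin_single (u : NESub G → k) (g : G) :
    coeffLin k G u (MonoidAlgebra.single g 1) = coeff k g u := by
  rw [← MonoidAlgebra.basis_apply, coeffLin, LinearMap.comp_apply]
  exact Module.Basis.constr_basis _ _ _ _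

end Coefficients

theorem equivFun_symm_smul {k G A : Type*} [Field k] [Group G] [DecidableEq G] [Ring A] [Algebra k A] [MulSemiringAction G A]
    (e : (NESub G → k) ≃ₐ[k] A) (he : ∀ (g : G) u, g • e u = e fun X => u (g⁻¹ • X))
    (g : G) (a : A) (X : NESub G) : e.symm (g • a) X = e.symm a (g⁻¹ • X) := by
  obtain ⟨u, rfl⟩ := e.surjective a
  rw [he, e.symm_apply_apply, e.symm_apply_apply]

/-! ### The standard dilation as functions -/

section Dilation

variable (k G : Type*) [Field k] [Group G] [Fintype G] [DecidableEq G]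

/-- Functions on nonempty subsets, as elements of the convolution algebra `Hom_k(kG, A_par(G))`. -/
def funToConv : (NESub G → k) →ₐ[k] WithConv (MonoidAlgebra k G →ₗ[k] Apar k G) :=
  AlgHom.ofLinearMap
    { toFun := fun u => WithConv.toConv (coeffLin k G u)
      map_add' := fun u v => by rw [map_add, WithConv.toConv_add]
      map_smul' := fun r u => by rw [map_smul, WithConv.toConv_smul]; rfl }
    (conv_ext fun g => by
      rw [convOne_single]
      exact (coeffLin_single 1 g).trans (map_one _))
    (fun u v => conv_ext fun g => by
      rw [conv_single]
      change coeffLin k G (u * v) _ = coeffLin k G u _ * coeffLin k G v _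
      rw [coeffLin_single, coeffLin_single, coeffLin_single, map_mul])

variable {k G}

theorem funToConv_single (u : NESub G → k) (g : G) :
    (funToConv k G u).ofConv (MonoidAlgebra.single g 1) = coeff k g u :=
  coeffLin_single u g

/-- The generators of the dilation come from functions: the value at g of h ⇀ φ(a) is (gh) • a, the
translate by gh of the extension of a by zero. -/
theorem funToConv_extZero (h : G) (a : Apar k G) :
    (funToConv k G fun Z => extZero (aparEquivFun k G a) (h⁻¹ • Z)).ofConv
      = homAct h (dilPhi k G a) :=
  kG_ext fun g => by
    rw [funToConv_single, homAct_dilPhi_single]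
    refine apar_ext fun X => ?_
    rw [aparEquivFun_coeff, aparEquivFun_act, mul_inv_rev, mul_smul]

/-- For z ∈ Z, the point mass at Z is the translate by z of the point mass at z⁻¹Z, which belongs to
A_par(G). Hence the point masses land on generators of the dilation. -/
theorem exists_extZero_eq_single (Z : NESub G) : ∃ (h : G) (a : Apar k G),
    (fun Z' => extZero (aparEquivFun k G a) (h⁻¹ • Z')) = Pi.single Z (1 : k) := by
  obtain ⟨z, hz⟩ := Z.2
  have hX : (1 : G) ∈ (z⁻¹ • Z).1 := by rwa [one_mem_smul_iff, inv_inv]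
  refine ⟨z, (aparEquivFun k G).symm (Pi.single ⟨z⁻¹ • Z, hX⟩ 1), funext fun Z' => ?_⟩
  rw [AlgEquiv.apply_symm_apply]
  rcases eq_or_ne Z' Z with rfl | hne
  · rw [extZero_pos _ hX, Pi.single_eq_same, Pi.single_eq_same]
  · rw [Pi.single_eq_of_ne hne]
    by_cases H : (1 : G) ∈ (z⁻¹ • Z').1
    · rw [extZero_pos _ H, Pi.single_eq_of_ne]
      intro e
      exact hne (smul_left_cancel _ (congrArg Subtype.val e))
    · rw [extZero_neg _ H]

theorem funToConv_mem (u : NESub G → k) : funToConv k G u ∈ parDilation k G := by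
  have hu : u = ∑ Z, u Z • Pi.single Z (1 : k) := by
    ext Z
    simp [Finset.sum_apply, Pi.single_apply]
  rw [hu, map_sum]
  refine sum_mem fun Z _ => ?_
  rw [map_smul]
  refine Subalgebra.smul_mem _ ?_ _
  obtain ⟨h, a, e⟩ := exists_extZero_eq_single (k := k) Z
  rw [← e, mem_parDilation, funToConv_extZero]
  exact Submodule.subset_span ⟨h, a, rfl⟩

theorem exists_funToConv {f : MonoidAlgebra k G →ₗ[k] Apar k G}
    (hf : f ∈ stdDilation k G (Apar k G)) : ∃ u, (funToConv k G u).ofConv = f := by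
  induction hf using Submodule.span_induction with
  | mem x hx =>
    obtain ⟨h, a, rfl⟩ := hx
    exact ⟨_, funToConv_extZero h a⟩
  | zero => exact ⟨0, by rw [map_zero]; rfl⟩
  | add x y _ _ hx hy =>
    obtain ⟨u, rfl⟩ := hx
    obtain ⟨v, rfl⟩ := hy
    exact ⟨u + v, by rw [map_add]; rfl⟩
  | smul r x _ hx =>
    obtain ⟨u, rfl⟩ := hx
    exact ⟨r • u, by rw [map_smul]; rfl⟩

variable (k G)

/-- The standard dilation of `A_par(G)` is the algebra of functions on nonempty subsets. -/
def funEquivParDil : (NESub G → k) ≃ₐ[k] ParDil k G :=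
  AlgEquiv.ofBijective
    ((funToConv k G).codRestrict (parDilation k G) funToConv_mem :
      (NESub G → k) →ₐ[k] parDilation k G)
    ⟨fun u v h => coeff_injective fun g => by
      rw [← funToConv_single, ← funToConv_single]
      exact congrArg (fun f => f.ofConv (MonoidAlgebra.single g 1)) (congrArg Subtype.val h),
    fun f => by
      obtain ⟨u, hu⟩ := exists_funToConv (mem_parDilation.mp f.2)
      exact ⟨u, Subtype.ext (WithConv.ext hu)⟩⟩

variable {k G}

theorem smul_funEquivParDil (g : G) (u : NESub G → k) :
    g • funEquivParDil k G u = funEquivParDil k G fun X => u (g⁻¹ • X) :=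
  ParDil.ext fun x => (dilAct_single g x _).trans
    ((funToConv_single u (x * g)).trans
      ((coeff_translate x g u).symm.trans (funToConv_single _ x).symm))

end Dilation

/-! ### {A_par, A_par} as functions -/

section HomObject

variable {k G : Type*} [Field k] [Group G]

/-- The composite is a ↦ ε_g a ε_g, and ε_g is an idempotent commuting with a. -/
theorem act_act_inv (g : G) (a : Apar k G) :
    (PartialModule.act (k := k) g (PartialModule.act (k := k) g⁻¹ a) : Apar k G)
      = aparEps k g * a := by
  refine Subtype.ext ?_
  rw [coe_act_Apar, coe_act_Apar, inv_inv]
  have h : eps k g * eps k g = eps k g := by rw [eps, ← mul_assoc, br_inv_br]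
  calc br k g * (br k g⁻¹ * a.1 * br k g) * br k g⁻¹ = eps k g * (a.1 * eps k g) := by
        simp only [eps, mul_assoc]
    _ = eps k g * a.1 := by rw [← eps_comm_Apar g a.2, ← mul_assoc, h]

/-- Acting by h⁻¹ and then h multiplies by ε_h in A_par(G) and restores the factor g in kG. A
morphism commutes with both moves. -/
theorem HomObj.map_aparEps_mul {f : Apar k G ⊗[k] MonoidAlgebra k G →ₗ[k] Apar k G}
    (hf : f ∈ HomObj k G (Apar k G) (Apar k G)) (h g : G) (a : Apar k G) :
    f ((aparEps k h * a) ⊗ₜ MonoidAlgebra.single g 1)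
      = aparEps k h * f (a ⊗ₜ MonoidAlgebra.single g 1) := by
  have e := hf h (PartialModule.act (k := k) h⁻¹ (a ⊗ₜ[k] MonoidAlgebra.single g (1 : k)))
  rw [hf h⁻¹, act_act_inv] at e
  rw [← e, act_tmul, act_tmul, act_act_inv, ← mul_assoc, MonoidAlgebra.single_mul_single,
    MonoidAlgebra.single_mul_single]
  simp

/-- Linearity over the generators ε_h gives linearity over A_par(G), so f is determined by the
elements f(1 ⊗ g). -/
theorem HomObj.map_mul {f : Apar k G ⊗[k] MonoidAlgebra k G →ₗ[k] Apar k G}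
    (hf : f ∈ HomObj k G (Apar k G) (Apar k G)) (g : G) (a b : Apar k G) :
    f ((a * b) ⊗ₜ MonoidAlgebra.single g 1) = a * f (b ⊗ₜ MonoidAlgebra.single g 1) := by
  induction a using apar_induction generalizing b with
  | heps h => exact HomObj.map_aparEps_mul hf h g b
  | hsmul r =>
    rw [← Algebra.smul_def, ← Algebra.smul_def, ← TensorProduct.smul_tmul', map_smul]
  | hadd a a' h h' => rw [add_mul, TensorProduct.add_tmul, map_add, h, h', add_mul]
  | hmul a a' h h' => rw [mul_assoc, h, h', mul_assoc]

variable [Fintype G] [DecidableEq G]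

/-- The map `a ⊗ g ↦ a u_g` attached to a function on nonempty subsets. -/
def funToHom (u : NESub G → k) : Apar k G ⊗[k] MonoidAlgebra k G →ₗ[k] Apar k G :=
  LinearMap.mul' k (Apar k G) ∘ₗ LinearMap.lTensor (Apar k G) (coeffLin k G u)

theorem funToHom_tmul (u : NESub G → k) (a : Apar k G) (g : G) :
    funToHom u (a ⊗ₜ MonoidAlgebra.single g 1) = a * coeff k g u := by
  rw [funToHom, LinearMap.comp_apply, LinearMap.lTensor_tmul, LinearMap.mul'_apply,
    coeffLin_single]

theorem funToHom_mem (u : NESub G → k) : funToHom u ∈ HomObj k G (Apar k G) (Apar k G) := by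
  intro h t
  have e : funToHom u ∘ₗ PartialModule.act (k := k) h
      = PartialModule.act (k := k) h ∘ₗ funToHom u := by
    refine tensor_ext fun a g => ?_
    rw [LinearMap.comp_apply, LinearMap.comp_apply, act_tmul, MonoidAlgebra.single_mul_single,
      mul_one, funToHom_tmul, funToHom_tmul, act_mul_coeff]
  exact LinearMap.congr_fun e t

/-- This is the gluing condition: the value of f(1 ⊗ g) at X depends only on g⁻¹X. -/
theorem aparEquivFun_map_eq {f : Apar k G ⊗[k] MonoidAlgebra k G →ₗ[k] Apar k G}
    (hf : f ∈ HomObj k G (Apar k G) (Apar k G)) (h g : G) (X : UnitSub G)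
    (hX : (1 : G) ∈ (h • X.1).1) :
    aparEquivFun k G (f (1 ⊗ₜ MonoidAlgebra.single (h * g) 1)) ⟨h • X.1, hX⟩
      = aparEquivFun k G (f (1 ⊗ₜ MonoidAlgebra.single g 1)) X := by
  have e := hf h (1 ⊗ₜ[k] MonoidAlgebra.single g (1 : k))
  -- By linearity f((h • 1) ⊗ hg) = (h • 1) f(1 ⊗ hg), and h • 1 has value 1 at hX because 1 ∈ X.
  rw [act_tmul, MonoidAlgebra.single_mul_single, mul_one,
    ← mul_one (PartialModule.act (k := k) h (1 : Apar k G)), HomObj.map_mul hf] at e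
  have e' := congrArg (fun a => aparEquivFun k G a ⟨h • X.1, hX⟩) e
  simp only [map_mul, Pi.mul_apply, aparEquivFun_act, inv_smul_smul, extZero_pos _ X.2, map_one,
    Pi.one_apply, one_mul] at e'
  exact e'

theorem exists_funToHom {f : Apar k G ⊗[k] MonoidAlgebra k G →ₗ[k] Apar k G}
    (hf : f ∈ HomObj k G (Apar k G) (Apar k G)) : ∃ u, funToHom u = f := by
  choose z hz using fun Z : NESub G => Z.2
  have hmem : ∀ Z : NESub G, (1 : G) ∈ ((z Z)⁻¹ • Z).1 := fun Z => by
    rw [one_mem_smul_iff, inv_inv]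
    exact hz Z
  -- If f is a ⊗ g ↦ a u_g, evaluating f(1 ⊗ z⁻¹) at z⁻¹Z must give u(Z). Any z ∈ Z may be used, by
  -- the gluing condition.
  refine ⟨fun Z => aparEquivFun k G (f (1 ⊗ₜ MonoidAlgebra.single (z Z)⁻¹ 1))
    ⟨(z Z)⁻¹ • Z, hmem Z⟩, tensor_ext fun a g => ?_⟩
  rw [funToHom_tmul, ← mul_one a, HomObj.map_mul hf, mul_one]
  congr 1
  refine apar_ext fun X => ?_
  rw [aparEquivFun_coeff]
  have hX : (1 : G) ∈ (((z (g⁻¹ • X.1))⁻¹ * g⁻¹) • X.1).1 := by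
    rw [mul_smul]
    exact hmem _
  -- With z the chosen element of g⁻¹X, translation by z⁻¹g⁻¹ takes the index g to z⁻¹ and X to
  -- z⁻¹g⁻¹X, the point where u(g⁻¹X) was defined.
  have e := aparEquivFun_map_eq hf _ g X hX
  rw [inv_mul_cancel_right] at e
  rw [← e]
  exact congrArg (aparEquivFun k G _) (Subtype.ext (mul_smul _ _ _).symm)

variable (k G)

/-- `{A_par(G), A_par(G)}` is the algebra of functions on nonempty subsets. -/
def funEquivEndObj : (NESub G → k) ≃ₐ[k] EndObj k G (Apar k G) :=
  AlgEquiv.ofBijective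
    (AlgHom.ofLinearMap
      { toFun := fun u => (⟨funToHom u, funToHom_mem u⟩ : EndObj k G (Apar k G))
        map_add' := fun u v => EndObj.ext fun a g => by
          change funToHom (u + v) _ = funToHom u _ + funToHom v _
          simp only [funToHom_tmul, _root_.map_add, mul_add]
        map_smul' := fun r u => EndObj.ext fun a g => by
          change funToHom (r • u) _ = r • funToHom u _
          simp only [funToHom_tmul, _root_.map_smul, mul_smul_comm] }
      (EndObj.ext fun a g => by
        change funToHom 1 _ = homUnit k G (Apar k G) _
        rw [funToHom_tmul, homUnit_tmul, _root_.map_one, mul_one])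
      (fun u v => EndObj.ext fun a g => by
        change funToHom (u * v) _ = homComp (funToHom u) (funToHom v) _
        rw [homComp_tmul, funToHom_tmul, funToHom_tmul, funToHom_tmul, _root_.map_mul, mul_assoc]))
    ⟨fun u v h => coeff_injective fun g => by
      have e : funToHom u (1 ⊗ₜ MonoidAlgebra.single g (1 : k))
          = funToHom v (1 ⊗ₜ MonoidAlgebra.single g (1 : k)) :=
        LinearMap.congr_fun (congrArg Subtype.val h) _
      rwa [funToHom_tmul, funToHom_tmul, one_mul, one_mul] at e,
    fun f => by
      obtain ⟨u, hu⟩ := exists_funToHom f.2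
      exact ⟨u, Subtype.ext hu⟩⟩

variable {k G}

theorem smul_funEquivEndObj (g : G) (u : NESub G → k) :
    g • funEquivEndObj k G u = funEquivEndObj k G fun X => u (g⁻¹ • X) :=
  EndObj.ext fun a x => (endAct_tmul g x _ a).trans
    ((funToHom_tmul u a (x * g)).trans (by
      rw [← coeff_translate]
      exact (funToHom_tmul _ a x).symm))

end HomObject

end PartialGlob

end

theorem mainTheorem8 (k : Type*) [Field k] (G : Type*) [Group G] [Fintype G] [DecidableEq G] :
    Nonempty (PartialGlob.KGlob k G ≃ₐ[k]
      PartialGlob.GroupoidAlgebra k (PartialGlob.GammaGlob G)) ∧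
    Nonempty (PartialGlob.GroupoidAlgebra k (PartialGlob.GammaGlob G) ≃ₐ[k]
      PartialGlob.Smash k G (PartialGlob.BAlg k G)) ∧
    Nonempty (PartialGlob.Smash k G (PartialGlob.BAlg k G) ≃ₐ[k]
      PartialGlob.Smash k G (PartialGlob.ParDil k G)) ∧
    Nonempty (PartialGlob.Smash k G (PartialGlob.ParDil k G) ≃ₐ[k]
      PartialGlob.Smash k G (PartialGlob.EndObj k G (PartialGlob.Apar k G))) ∧
    Nonempty (PartialGlob.Smash k G (PartialGlob.EndObj k G (PartialGlob.Apar k G)) ≃ₐ[k]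
      PartialGlob.KGglob k G) :=
  -- Each of the next three isomorphisms is a composite through k_glob G, and the last one is an
  -- equality by definition.
  ⟨⟨PartialGlob.kGlobEquivGroupoid k G⟩,
    ⟨(PartialGlob.kGlobEquivGroupoid k G).symm.trans
      (PartialGlob.kGlobEquivSmash (PartialGlob.bEquivFun k G) PartialGlob.bEquivFun_smul)⟩,
    ⟨(PartialGlob.kGlobEquivSmash (PartialGlob.bEquivFun k G)
      PartialGlob.bEquivFun_smul).symm.trans
      (PartialGlob.kGlobEquivSmash (PartialGlob.funEquivParDil k G).symm
        (PartialGlob.equivFun_symm_smul _ PartialGlob.smul_funEquivParDil))⟩,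
    ⟨(PartialGlob.kGlobEquivSmash (PartialGlob.funEquivParDil k G).symm
      (PartialGlob.equivFun_symm_smul _ PartialGlob.smul_funEquivParDil)).symm.trans
      (PartialGlob.kGlobEquivSmash (PartialGlob.funEquivEndObj k G).symm
        (PartialGlob.equivFun_symm_smul _ PartialGlob.smul_funEquivEndObj))⟩,
    ⟨AlgEquiv.refl⟩⟩
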